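/- Let $C$ be a finite set of candidates. A weak order on $C$ is a complete, transitive (hence reflexive) binary relation on $C$; write $a > b$ for strict preference and $a \sim b$ for a tie. A preference profile $V$ is a finite collection of weak orders on $C$, one for each voter. An axis is a total ordering $L$ of $C$. The profile $V$ is single-peaked with outside options with respect to $L$ if for every $v \in V$ the axis $L$ can be split, from left to right, into five segments $O_1, X, Y, Z, O_2$ ($O_1, X, Z, O_2$ possibly empty) such that $Y = \{p\}$, where $p$ is the unique most preferred candidate of $v$; $v$ is strictly increasing along $X$ (each candidate is strictly preferred to the one on its left) and strictly decreasing along $Z$ (each candidate is strictly preferred to the one on its right); $a > b$ in $v$ for all $a \in X \cup Y \cup Z$ and $b \in O_1 \cup O_2$; and $x \sim y$ in $v$ for all $x, y \in O_1 \cup O_2$. Theorem. Given a preference profile $V$ of weak orders, it can be decided in polynomial time whether there exists an axis $L$ such that $V$ is single-peaked with outside options with respect to $L$. That is, there is a deterministic Turing machine which, given any profile $V$, presented by the number of candidates in unary followed by the $0/1$ comparison matrix of each vote, halts after a number of steps bounded by a polynomial in the length of this presentation and outputs whether such an axis exists. -/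

import Mathlib

/-- A weak order on `C` (a vote with ties): a complete and transitive (hence reflexive) binary
relation; `v.rel a b` says that `a` is at least as good as `b` according to `v`. -/
structure WeakOrder (C : Type) where
  rel : C → C → Prop
  complete : ∀ a b, rel a b ∨ rel b a
  transitive : ∀ a b c, rel a b → rel b c → rel a c

/-- `a > b`: the voter strictly prefers `a` to `b`. -/
def WeakOrder.Prefers {C : Type} (v : WeakOrder C) (a b : C) : Prop :=
  v.rel a b ∧ ¬ v.rel b a

/-- `a ∼ b`: the voter is indifferent between `a` and `b`. -/
def WeakOrder.Tied {C : Type} (v : WeakOrder C) (a b : C) : Prop :=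
  v.rel a b ∧ v.rel b a

/-- An axis: a total ordering of the finitely many candidates, given as the list of all
candidates from left to right, each occurring exactly once. -/
structure Axis (C : Type) where
  order : List C
  nodup : order.Nodup
  complete : ∀ c, c ∈ order

/-- `v` is strictly increasing along the segment `S` (listed from left to right): each candidate
is strictly preferred to the candidate on its left. -/
def WeakOrder.StrictlyIncreasingAlong {C : Type} (v : WeakOrder C) (S : List C) : Prop :=
  S.IsChain (fun a b => v.Prefers b a)

/-- `v` is strictly decreasing along the segment `S` (listed from left to right): each candidate
is strictly preferred to the candidate on its right. -/
def WeakOrder.StrictlyDecreasingAlong {C : Type} (v : WeakOrder C) (S : List C) : Prop :=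
  S.IsChain (fun a b => v.Prefers a b)

/-- The condition on a single vote `v`: the axis splits, from left to right, into segments
`O₁`, `X`, `Y = [p]`, `Z`, `O₂`, all but `Y` possibly empty, where `p` is the unique most
preferred candidate of `v`. -/
def WeakOrder.IsSinglePeakedWithOutsideOptions {C : Type} (v : WeakOrder C) (L : Axis C) : Prop :=
  ∃ (O₁ X : List C) (p : C) (Z O₂ : List C),
    L.order = O₁ ++ X ++ [p] ++ Z ++ O₂ ∧
    (∀ c, c ≠ p → v.Prefers p c) ∧
    v.StrictlyIncreasingAlong X ∧
    v.StrictlyDecreasingAlong Z ∧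
    (∀ a ∈ X ++ [p] ++ Z, ∀ b ∈ O₁ ++ O₂, v.Prefers a b) ∧
    (∀ x ∈ O₁ ++ O₂, ∀ y ∈ O₁ ++ O₂, v.Tied x y)

/-- A preference profile of weak orders over a finite set of candidates, which are numbered
`0, …, numCandidates - 1`; the list `votes` holds one weak order for each voter. -/
structure Profile where
  numCandidates : ℕ
  votes : List (WeakOrder (Fin numCandidates))

/-- The profile is single-peaked with outside options with respect to the axis `L`. -/
def Profile.IsSinglePeakedWithOutsideOptions (V : Profile) (L : Axis (Fin V.numCandidates)) :
    Prop :=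
  ∀ v ∈ V.votes, v.IsSinglePeakedWithOutsideOptions L

open Classical in
/-- A vote over `m` candidates as a string over the alphabet `Γ'` (bits, brackets, comma): between
brackets, for each candidate `a`, the bits `v.rel a 0, …, v.rel a (m - 1)` followed by a comma. -/
noncomputable def WeakOrder.encode {m : ℕ} (v : WeakOrder (Fin m)) : List Computability.Γ' :=
  [.bra] ++
    (List.ofFn fun a => (List.ofFn fun b => Computability.Γ'.bit (decide (v.rel a b))) ++
      [.comma]).flatten ++
    [.ket]

/-- A profile as a string: the number of candidates in unary, a comma, and then the votes. -/
noncomputable def Profile.encode (V : Profile) : List Computability.Γ' :=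
  List.replicate V.numCandidates (.bit true) ++ [.comma] ++ V.votes.flatMap WeakOrder.encode

theorem WeakOrder.length_encode {m : ℕ} (v : WeakOrder (Fin m)) :
    v.encode.length = m * (m + 1) + 2 := by
  simp [WeakOrder.encode, List.length_flatten, List.map_ofFn, Function.comp_def]

theorem WeakOrder.encode_injective {m : ℕ} :
    Function.Injective (WeakOrder.encode (m := m)) := by
  intro v w h
  simp only [WeakOrder.encode, List.append_cancel_right_eq, List.append_cancel_left_eq] at h
  have h2 := List.eq_iff_flatten_eq.2 ⟨h, by simp [List.map_ofFn, Function.comp_def]⟩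
  have h3 := List.ofFn_injective h2
  have h4 : ∀ a b, v.rel a b ↔ w.rel a b := by
    intro a b
    have h5 := congrFun h3 a
    simp only [List.append_cancel_right_eq] at h5
    have h6 := congrFun (List.ofFn_injective h5) b
    simpa using h6
  cases v; cases w
  simp only [WeakOrder.mk.injEq]
  ext a b
  exact h4 a b

/-- Distinct profiles are represented by distinct strings. -/
theorem Profile.encode_injective : Function.Injective Profile.encode := by
  have key : ∀ (k l : ℕ) (s t : List Computability.Γ'),
      List.replicate k (Computability.Γ'.bit true) ++ [.comma] ++ s =
        List.replicate l (.bit true) ++ [.comma] ++ t → k = l ∧ s = t := by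
    intro k
    induction k with
    | zero => intro l s t h; cases l <;> simp_all [List.replicate_succ]
    | succ k ih =>
      intro l s t h
      cases l with
      | zero => simp [List.replicate_succ] at h
      | succ l =>
        have := ih l s t (by simpa [List.replicate_succ] using h)
        exact ⟨by rw [this.1], this.2⟩
  have votes_eq : ∀ (m : ℕ) (s t : List (WeakOrder (Fin m))),
      s.flatMap WeakOrder.encode = t.flatMap WeakOrder.encode → s = t := by
    intro m s
    induction s with
    | nil =>
      intro t h
      cases t with
      | nil => rfl
      | cons w t => simp [WeakOrder.encode] at h
    | cons v s ih =>
      intro t h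
      cases t with
      | nil => simp [WeakOrder.encode] at h
      | cons w t =>
        simp only [List.flatMap_cons] at h
        have h' := List.append_inj h (by simp [WeakOrder.length_encode])
        rw [WeakOrder.encode_injective h'.1, ih t h'.2]
  rintro ⟨m, s⟩ ⟨n, t⟩ h
  obtain ⟨h1, h2⟩ := key m n _ _ h
  subst h1
  rw [votes_eq m s t h2]

open Classical in
/-- The decision problem `p`, with inputs presented as strings through `enc`, is decidable in
polynomial time: some (multi-stack) Turing machine halts on every input `enc a` within a number
of steps bounded by a polynomial in the length of `enc a`, with output the truth value of `p a`. -/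
def DecidableInPolyTime {α Γ : Type} (enc : α → List Γ) (p : α → Prop) : Prop :=
  Nonempty (Turing.TM2ComputableInPolyTime enc Computability.encodeBool fun a => decide (p a))

/-!
A vote with a unique top candidate is single-peaked with outside options with respect to an axis if
and only if certain sets of candidates, read off from the vote, are intervals of the axis. If `a`
and `b` belong to such a set and `c` does not, then `a` and `b` lie on the same side of `c`, so the
order of `(a, c)` determines that of `(b, c)`. An axis can only exist if no chain of such steps
links a pair to its reverse. Conversely, if no pair is linked to its reverse, orient each class of
linked pairs, together with the class of the reversed pairs, in such a way that its
lexicographically least pair keeps its order: as in Golumbic's decomposition of comparability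
graphs, this orientation is transitive, and so it is an axis.

Being linked is the transitive closure of a relation that is first-order definable on the encoding
of the profile. A first-order formula about a word is evaluated in polynomial time by nested loops
over the positions of the word, and polynomially many rounds that tabulate a first-order formula
compute the transitive closure.
-/

/-! ### Programs over stacks -/

/-- Structured programs over stacks indexed by `K`, with stack symbols in `A` and a Boolean flag:
`pop k p` pops the stack `k` and continues with `p o`, where `o` is the symbol popped, if any;
`popWhile k t p` pops the stack `k` and runs `p c` as long as the symbol `c` popped satisfies `t`;
`assign` changes the flag, and `ite` branches on it. -/
inductive StackProgram (K A : Type) : Type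
  | push (k : K) (c : A)
  | assign (f : Bool → Bool)
  | pop (k : K) (p : Option A → StackProgram K A)
  | seq (p q : StackProgram K A)
  | ite (p q : StackProgram K A)
  | popWhile (k : K) (t : A → Bool) (p : A → StackProgram K A)

namespace StackProgram

variable {K A : Type}

/-- `Exec p x y n`: started with the flag and the stacks `x`, the program `p` terminates with the
flag and the stacks `y` after at most `n` steps. -/
inductive Exec [DecidableEq K] :
    StackProgram K A → Bool × (K → List A) → Bool × (K → List A) → ℕ → Prop
  | push (k c b S) : Exec (.push k c) (b, S) (b, Function.update S k (c :: S k)) 1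
  | assign (f b S) : Exec (.assign f) (b, S) (f b, S) 1
  | pop {k p b S y n} : Exec (p (S k).head?) (b, Function.update S k (S k).tail) y n →
      Exec (.pop k p) (b, S) y (1 + n)
  | seq {p q x y z m n} : Exec p x y m → Exec q y z n → Exec (.seq p q) x z (m + n)
  | ite {p q x y n} : Exec (bif x.1 then p else q) x y n → Exec (.ite p q) x y (1 + n)
  | popWhile_done {k t p b S} : (∀ c ∈ (S k).head?, t c = false) →
      Exec (.popWhile k t p) (b, S) (b, Function.update S k (S k).tail) 1
  | popWhile_step {k t p b S c l y z m n} : S k = c :: l → t c = true →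
      Exec (p c) (b, Function.update S k l) y m → Exec (.popWhile k t p) y z n →
      Exec (.popWhile k t p) (b, S) z (1 + m + n)
  | mono {p x y m n} : Exec p x y m → m ≤ n → Exec p x y n

/-- The control points of a program: the points where an instruction is to be executed. -/
def Label : StackProgram K A → Type
  | .push _ _ => Unit
  | .assign _ => Unit
  | .pop _ p => Option (Σ o, (p o).Label)
  | .seq p q => p.Label ⊕ q.Label
  | .ite p q => Option (p.Label ⊕ q.Label)
  | .popWhile _ _ p => Option (Σ c, (p c).Label)

instance Label.instFinite [Finite A] : (p : StackProgram K A) → Finite p.Label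
  | .push _ _ => inferInstanceAs (Finite Unit)
  | .assign _ => inferInstanceAs (Finite Unit)
  | .pop _ p =>
    haveI := fun o => Label.instFinite (p o)
    inferInstanceAs (Finite (Option (Σ o, (p o).Label)))
  | .seq p q =>
    haveI := Label.instFinite p; haveI := Label.instFinite q
    inferInstanceAs (Finite (p.Label ⊕ q.Label))
  | .ite p q =>
    haveI := Label.instFinite p; haveI := Label.instFinite q
    inferInstanceAs (Finite (Option (p.Label ⊕ q.Label)))
  | .popWhile _ _ p =>
    haveI := fun c => Label.instFinite (p c)
    inferInstanceAs (Finite (Option (Σ c, (p c).Label)))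

/-- The control point at which a program starts. -/
def entry : (p : StackProgram K A) → p.Label
  | .push _ _ => ()
  | .assign _ => ()
  | .pop _ _ => none
  | .seq p _ => .inl p.entry
  | .ite _ _ => none
  | .popWhile _ _ _ => none

/-- The alphabets of the stacks of a machine: those of the program, and one for the output. -/
abbrev Alphabet (K A : Type) : Option K → Type
  | none => Bool
  | some _ => A

/-- The machine code of a program. The memory of the machine holds the flag and the symbol popped
last, control points are mapped to labels of the machine by `e`, and on termination control passes
to the label `exit`. -/
def code {Λ : Type} : (p : StackProgram K A) → (p.Label → Λ) → Λ → p.Label →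
    Turing.TM2.Stmt (Alphabet K A) Λ (Bool × Option A)
  | .push k c, _, exit, _ => .push (some k) (fun _ => c) (.goto fun _ => exit)
  | .assign f, _, exit, _ => .load (Prod.map f id) (.goto fun _ => exit)
  | .pop k p, e, _, none =>
    .pop (some k) (fun s o => (s.1, o)) (.goto fun s => e (some ⟨s.2, (p s.2).entry⟩))
  | .pop _ p, e, exit, some ⟨o, l⟩ => (p o).code (fun l => e (some ⟨o, l⟩)) exit l
  | .seq p q, e, _, .inl l => p.code (fun l => e (.inl l)) (e (.inr q.entry)) l
  | .seq _ q, e, exit, .inr l => q.code (fun l => e (.inr l)) exit l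
  | .ite p q, e, _, none =>
    .goto fun s => bif s.1 then e (some (.inl p.entry)) else e (some (.inr q.entry))
  | .ite p _, e, exit, some (.inl l) => p.code (fun l => e (some (.inl l))) exit l
  | .ite _ q, e, exit, some (.inr l) => q.code (fun l => e (some (.inr l))) exit l
  | .popWhile k t p, e, exit, none =>
    .pop (some k) (fun s o => (s.1, o)) (.goto fun s =>
      s.2.elim exit fun c => bif t c then e (some ⟨c, (p c).entry⟩) else exit)
  | .popWhile _ _ p, e, _, some ⟨c, l⟩ => (p c).code (fun l => e (some ⟨c, l⟩)) (e none) l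

/-- The stacks of the machine, the output stack being empty. -/
def contents (S : K → List A) : (k : Option K) → List (Alphabet K A k)
  | none => []
  | some k => S k

/-- The configuration of the machine at the label `l` with the flag and the stacks `x` and the
symbol `o` popped last. -/
def config {Λ : Type} (l : Option Λ) (x : Bool × (K → List A)) (o : Option A) :
    Turing.TM2.Cfg (Alphabet K A) Λ (Bool × Option A) :=
  ⟨l, (x.1, o), contents x.2⟩

section Simulation

variable [DecidableEq K] {Λ : Type} {M : Λ → Turing.TM2.Stmt (Alphabet K A) Λ (Bool × Option A)}

theorem update_contents (S : K → List A) (k : K) (l : List A) :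
    Function.update (contents S) (some k) l = contents (Function.update S k l) := by
  funext j
  rcases j with _ | j
  · rfl
  · by_cases h : j = k
    · subst h; simp [contents]
    · simp [contents, h]

/-- Whatever symbol has been popped last, the machine `M` comes from the label `l` with flag and
stacks `x` to the label `l'` with flag and stacks `y` within `n` steps. -/
def RunsTo (M : Λ → Turing.TM2.Stmt (Alphabet K A) Λ (Bool × Option A)) (l : Λ)
    (x : Bool × (K → List A)) (l' : Λ) (y : Bool × (K → List A)) (n : ℕ) : Prop :=
  ∀ o, ∃ m ≤ n, ∃ o', (flip bind (Turing.TM2.step M))^[m] (some (config (some l) x o)) =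
    some (config (some l') y o')

variable {l₁ l₂ l₃ : Λ} {x y z : Bool × (K → List A)} {m n : ℕ}

theorem RunsTo.trans (h : RunsTo M l₁ x l₂ y m) (h' : RunsTo M l₂ y l₃ z n) :
    RunsTo M l₁ x l₃ z (m + n) := by
  intro o
  obtain ⟨i, hi, o', h⟩ := h o
  obtain ⟨j, hj, o'', h'⟩ := h' o'
  refine ⟨i + j, by omega, o'', ?_⟩
  rw [Nat.add_comm, Function.iterate_add_apply, h, h']

theorem RunsTo.mono (h : RunsTo M l₁ x l₂ y m) (hmn : m ≤ n) : RunsTo M l₁ x l₂ y n := fun o =>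
  (h o).imp fun _ h => ⟨h.1.trans hmn, h.2⟩

theorem RunsTo.of_step (h : ∀ o, ∃ o', Turing.TM2.step M (config (some l₁) x o) =
    some (config (some l₂) y o')) : RunsTo M l₁ x l₂ y 1 := fun o =>
  (h o).elim fun o' h => ⟨1, le_rfl, o', by simpa [flip] using h⟩

theorem RunsTo.pop {k : K} {b : Bool} {S : K → List A} {g : Bool × Option A → Λ}
    (hM : M l₁ = .pop (some k) (fun s o => (s.1, o)) (.goto g)) :
    RunsTo M l₁ (b, S) (g (b, (S k).head?)) (b, Function.update S k (S k).tail) 1 :=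
  .of_step fun _ => ⟨(S k).head?, by
    simp only [config, Turing.TM2.step, hM, Turing.TM2.stepAux, ← update_contents]; rfl⟩

theorem Exec.runsTo {p : StackProgram K A} (h : Exec p x y n) (e : p.Label → Λ) (exit : Λ)
    (hM : ∀ l, M (e l) = p.code e exit l) : RunsTo M (e p.entry) x exit y n := by
  induction h generalizing exit with
  | push k c b S =>
    refine .of_step fun o => ⟨o, ?_⟩
    simp only [config, Turing.TM2.step, hM, code, Turing.TM2.stepAux, ← update_contents]
    rfl
  | assign f b S =>
    refine .of_step fun o => ⟨o, ?_⟩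
    simp only [config, Turing.TM2.step, hM, code, Turing.TM2.stepAux, Prod.map, id]
  | @pop k p b S y n _ ih =>
    exact (RunsTo.pop (hM none)).trans
      (ih (fun l => e (some ⟨_, l⟩)) exit fun l => hM (some ⟨_, l⟩))
  | seq _ _ ih₁ ih₂ =>
    exact (ih₁ (fun l => e (.inl l)) _ fun l => hM (.inl l)).trans
      (ih₂ (fun l => e (.inr l)) exit fun l => hM (.inr l))
  | @ite p q x y n _ ih =>
    obtain ⟨_ | _, S⟩ := x
    · refine RunsTo.trans (.of_step fun o => ⟨o, ?_⟩)
        (ih (fun l => e (some (.inr l))) exit fun l => hM (some (.inr l)))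
      rw [config, Turing.TM2.step, entry, hM none]
      rfl
    · refine RunsTo.trans (.of_step fun o => ⟨o, ?_⟩)
        (ih (fun l => e (some (.inl l))) exit fun l => hM (some (.inl l)))
      rw [config, Turing.TM2.step, entry, hM none]
      rfl
  | @popWhile_done k t p b S h =>
    have h' := RunsTo.pop (S := S) (b := b) (hM none)
    cases hS : (S k).head? with
    | none => simpa only [hS, Option.elim_none, entry] using h'
    | some c => simpa only [hS, Option.elim_some, h c hS, cond_false, entry] using h'
  | @popWhile_step k t p b S c l y z m n hS ht _ _ ih₁ ih₂ =>
    have h' := RunsTo.pop (S := S) (b := b) (hM none)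
    simp only [hS, List.head?_cons, List.tail_cons, Option.elim_some, ht, cond_true] at h'
    exact (h'.trans (ih₁ (fun l => e (some ⟨c, l⟩)) (e none) fun l => hM (some ⟨c, l⟩))).trans
      (ih₂ e exit hM)
  | mono _ hmn ih => exact (ih e exit hM).mono hmn

end Simulation

variable [DecidableEq K]

/-- The machine that runs the program `p` with its input on the stack `k`, and outputs the flag. -/
noncomputable def toMachine [Fintype K] [Fintype A] (p : StackProgram K A) (k : K) :
    Turing.FinTM2 where
  K := Option K
  k₀ := some k
  k₁ := none
  Γ := Alphabet K A
  Λ := Option p.Label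
  main := some p.entry
  ΛFin := Fintype.ofFinite _
  σ := Bool × Option A
  initialState := (false, none)
  Γk₀Fin := inferInstanceAs (Fintype A)
  m
    | some l => p.code some none l
    | none => .push none Prod.fst (.load (fun _ => (false, none)) .halt)

theorem initList_toMachine [Fintype K] [Fintype A] (p : StackProgram K A) (k : K) (w : List A) :
    Turing.initList (p.toMachine k) w =
      config (some (some p.entry)) (false, Function.update (fun _ => []) k w) none := by
  simp only [config, toMachine, Turing.initList]
  congr 1
  funext j
  rcases j with _ | j
  · simp [contents]
  · by_cases hj : j = k
    · subst hj
      simp only [contents, Function.update_self]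
      exact dif_pos rfl
    · simp [contents, hj]

theorem step_toMachine_none [Fintype K] [Fintype A] (p : StackProgram K A) (k : K) (b : Bool)
    (o : Option A) :
    Turing.TM2.step (p.toMachine k).m (config (some none) (b, fun _ => []) o) =
      some (Turing.haltList (p.toMachine k) [b]) := by
  simp only [config, Turing.TM2.step, toMachine, Turing.TM2.stepAux, Turing.haltList]
  congr 2
  funext j
  rcases j with _ | j <;> simp only [contents, reduceCtorEq, ↓reduceDIte] <;> rfl

theorem Exec.outputsInTime [Fintype K] [Fintype A] {p : StackProgram K A} {k : K} {w : List A}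
    {b : Bool} {n : ℕ}
    (h : Exec p (false, Function.update (fun _ => []) k w) (b, fun _ => []) n) :
    Nonempty (Turing.TM2OutputsInTime (p.toMachine k) w (some [b]) (n + 1)) := by
  obtain ⟨m, hm, o, hrun⟩ :=
    h.runsTo (M := (p.toMachine k).m) some none (fun _ => rfl) none
  refine ⟨⟨⟨m + 1, ?_⟩, Nat.succ_le_succ hm⟩⟩
  rw [initList_toMachine]
  refine (Function.iterate_succ_apply' _ _ _).trans ?_
  refine (congrArg _ hrun).trans ?_
  exact step_toMachine_none p k b o

open Classical in
theorem decidableInPolyTime [Finite K] {α : Type} {A : Type} [Finite A] (enc : α → List A)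
    (P : α → Prop) (p : StackProgram K A) (k : K) (Q : Polynomial ℕ)
    (h : ∀ a, Exec p (false, Function.update (fun _ => []) k (enc a))
      (decide (P a), fun _ => []) (Q.eval (enc a).length)) : DecidableInPolyTime enc P := by
  have := Fintype.ofFinite K
  have := Fintype.ofFinite A
  have outputs (a : α) (w : List A) (hw : w = enc a) :
      Nonempty (Turing.TM2OutputsInTime (p.toMachine k) w (some [decide (P a)])
        ((Q + 1).eval (enc a).length)) := by
    subst hw
    simpa only [Polynomial.eval_add, Polynomial.eval_one] using (h a).outputsInTime
  exact ⟨{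
    tm := p.toMachine k
    inputAlphabet := Equiv.refl A
    outputAlphabet := Equiv.refl Bool
    time := Q + 1
    outputsFun := fun a => Classical.choice (outputs a _ (List.map_id _)) }⟩

open Computability (Γ')

section Loops

variable {K A : Type}

/-- The program that changes nothing. -/
def skip : StackProgram K A := .assign id

/-- Empty the stack `k`. -/
def clear (k : K) : StackProgram K A := .popWhile k (fun _ => true) fun _ => skip

/-- Move the stack `k` symbol by symbol onto the stack `j`. -/
def move (k j : K) : StackProgram K A := .popWhile k (fun _ => true) (.push j)

/-- The number `n` in unary. -/
def unary (n : ℕ) : List Γ' := List.replicate n (.bit true)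

/-- Push the length of the stack `k` in unary on the stack `j`, by means of the empty stack
`carry`. -/
def pushLength (k carry j : K) : StackProgram K Γ' :=
  .seq (.popWhile k (fun _ => true) fun c => .seq (.push carry c) (.push j (.bit true)))
    (move carry k)

/-- Pop a unary number from the stack `control` and run `p` as many times; the symbol below this
number is popped as well. -/
def countDown (control : K) (p : StackProgram K Γ') : StackProgram K Γ' :=
  .popWhile control (fun c => decide (c = .bit true)) fun _ => p

/-- Move the unary number on the stack `index` off that stack, and decide whether the symbol at
this position of the stack `k` is `c`; the symbols above are kept on the stack `carry`. -/
def readAt (k carry index : K) (c : Option Γ') : StackProgram K Γ' :=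
  .seq (countDown index (.pop k fun o => o.elim skip (.push carry)))
    (.seq (.pop k fun o => .seq (o.elim skip (.push k)) (.assign fun _ => decide (o = c)))
      (move carry k))

/-- Run `p` as many times as there are symbols on the stack `k`. The stack `control` keeps the
number of remaining runs, above a blank, so that such loops can be nested. -/
def forLength (k carry control : K) (p : StackProgram K Γ') : StackProgram K Γ' :=
  .seq (.push control .blank) (.seq (pushLength k carry control) (countDown control p))

/-- The stacks `S`, with the first `i` symbols of the stack `k` moved to the stack `carry`. -/
def splitAt [DecidableEq K] (k carry : K) (S : K → List Γ') (i : ℕ) : K → List Γ' :=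
  Function.update (Function.update S k ((S k).drop i)) carry ((S k).take i).reverse

theorem unary_succ (n : ℕ) : unary (n + 1) = .bit true :: unary n := rfl

@[simp]
theorem length_unary (n : ℕ) : (unary n).length = n := List.length_replicate

theorem unary_add (m n : ℕ) : unary (m + n) = unary m ++ unary n := by
  simp only [unary, List.replicate_add]

variable [DecidableEq K]

theorem Exec.congr {p : StackProgram K A} {x y z : Bool × (K → List A)} {m n : ℕ}
    (h : Exec p x y m) (hyz : y = z) (hmn : m ≤ n) : Exec p x z n :=
  hyz ▸ h.mono hmn

theorem exec_skip (x : Bool × (K → List A)) : Exec skip x x 1 := .assign _ _ _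

theorem exec_clear (k : K) (b : Bool) (S : K → List A) :
    Exec (clear k) (b, S) (b, Function.update S k []) (2 * (S k).length + 1) := by
  induction h : S k generalizing S with
  | nil =>
    exact (Exec.popWhile_done (k := k) (S := S) (b := b) (by simp [h])).congr (by simp [h])
      (by simp)
  | cons c l ih =>
    have rest := ih (Function.update S k l) (by simp)
    rw [Function.update_idem] at rest
    exact (Exec.popWhile_step h rfl (exec_skip _) rest).mono
      (by simp only [List.length_cons]; omega)

theorem exec_move {k j : K} (hkj : k ≠ j) (b : Bool) (S : K → List A) :
    Exec (move k j) (b, S)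
      (b, Function.update (Function.update S j ((S k).reverse ++ S j)) k [])
      (2 * (S k).length + 1) := by
  induction h : S k generalizing S with
  | nil =>
    exact (Exec.popWhile_done (k := k) (S := S) (b := b) (by simp [h])).congr (by simp [h])
      (by simp)
  | cons c l ih =>
    have first := Exec.push j c b (Function.update S k l)
    have rest := ih (Function.update (Function.update S k l) j (c :: Function.update S k l j))
      (by simp [hkj])
    refine (Exec.popWhile_step h rfl first rest).congr ?_ (by simp only [List.length_cons]; omega)
    simp [hkj.symm, Function.update_comm hkj]

variable {k carry control index j : K}

theorem exec_pushLength (hkc : k ≠ carry) (hkj : k ≠ j) (hcj : carry ≠ j) (b : Bool)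
    (S : K → List Γ') (hS : S carry = []) :
    Exec (pushLength k carry j) (b, S)
      (b, Function.update S j (unary (S k).length ++ S j)) (5 * (S k).length + 2) := by
  have count (l r : List Γ') (S : K → List Γ') (hl : S k = l) (hr : S carry = r) :
      Exec (.popWhile k (fun _ => true) fun c => .seq (.push carry c) (.push j (.bit true)))
        (b, S) (b, Function.update (Function.update (Function.update S j
          (unary l.length ++ S j)) carry (l.reverse ++ r)) k []) (3 * l.length + 1) := by
    induction l generalizing r S with
    | nil =>
      exact (Exec.popWhile_done (k := k) (S := S) (b := b) (by simp [hl])).congr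
        (by simp [hl, ← hr, unary]) (by simp)
    | cons c l ih =>
      have rest := ih (c :: r) (Function.update (Function.update (Function.update S k l)
        carry (c :: r)) j (.bit true :: S j)) (by simp [hkc, hkj]) (by simp [hcj])
      have run := (Exec.push carry c b (Function.update S k l)).seq (.push j (.bit true) b _)
      simp only [Function.update_of_ne hkc.symm, Function.update_of_ne hkj.symm,
        Function.update_of_ne hcj.symm, hr] at run
      refine (Exec.popWhile_step hl rfl run rest).congr (congrArg (Prod.mk b) ?_)
        (by simp only [List.length_cons]; omega)
      funext i
      by_cases h₁ : i = k <;> by_cases h₂ : i = carry <;> by_cases h₃ : i = j <;>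
        simp_all [unary, List.replicate_succ']
  have back := exec_move (k := carry) (j := k) hkc.symm b
    (Function.update (Function.update (Function.update S j (unary (S k).length ++ S j)) carry
      ((S k).reverse ++ [])) k [])
  refine ((count (S k) [] S rfl hS).seq back).congr (congrArg (Prod.mk b) ?_) ?_
  · funext i
    have hck := hkc.symm
    by_cases h₁ : i = k <;> by_cases h₂ : i = carry <;> by_cases h₃ : i = j <;> simp_all
  · simp only [List.append_nil, Function.update_of_ne hkc.symm, Function.update_self,
      List.length_reverse]
    omega

theorem exec_countDown {p : StackProgram K Γ'} {n t : ℕ} (b : ℕ → Bool) (S : ℕ → K → List Γ')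
    (hp : ∀ i < n, ∀ l, Exec p (b i, Function.update (S i) control l)
      (b (i + 1), Function.update (S (i + 1)) control l) t) {l : List Γ'}
    (hl : ∀ c ∈ l.head?, c ≠ .bit true) :
    Exec (countDown control p) (b 0, Function.update (S 0) control (unary n ++ l))
      (b n, Function.update (S n) control l.tail) (n * (t + 1) + 1) := by
  induction n generalizing b S with
  | zero =>
    exact (Exec.popWhile_done (by simpa [unary] using hl)).congr (by simp [unary]) (by simp)
  | succ n ih =>
    have rest := ih (fun i => b (i + 1)) (fun i => S (i + 1)) fun i hi => hp (i + 1) (by omega)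
    have first := hp 0 n.succ_pos (unary n ++ l)
    refine (Exec.popWhile_step (c := .bit true) (l := unary n ++ l) (by simp [unary_succ])
      (by simp) (by simpa using first) rest).mono ?_
    ring_nf
    omega

theorem exec_forLength (hkc : k ≠ carry) (hkr : k ≠ control) (hcr : carry ≠ control)
    {p : StackProgram K Γ'} {n t : ℕ} (b : ℕ → Bool) (S : ℕ → K → List Γ')
    (hcarry : S 0 carry = []) (hn : (S 0 k).length = n)
    (hp : ∀ i < n, ∀ l, Exec p (b i, Function.update (S i) control l)
      (b (i + 1), Function.update (S (i + 1)) control l) t) :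
    Exec (forLength k carry control p) (b 0, S 0)
      (b n, Function.update (S n) control (S 0 control)) (n * (t + 6) + 4) := by
  have count := exec_pushLength hkc hkr hcr (b 0)
    (Function.update (S 0) control (.blank :: S 0 control)) (by simp [hcr, hcarry])
  simp only [Function.update_of_ne hkr, hn, Function.update_self, Function.update_idem] at count
  have loop := exec_countDown b S hp (l := .blank :: S 0 control) (by simp)
  refine ((Exec.push control .blank (b 0) (S 0)).seq (count.seq loop)).mono ?_
  ring_nf
  omega

theorem exec_seek (hkc : k ≠ carry) (hki : k ≠ index) (hci : carry ≠ index) (b : Bool)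
    (S : K → List Γ') (i : ℕ) (l : List Γ') :
    Exec (.pop k fun o => o.elim skip (.push carry))
      (b, Function.update (splitAt k carry S i) index l)
      (b, Function.update (splitAt k carry S (i + 1)) index l) 2 := by
  have hck := hkc.symm
  refine .pop (n := 1) ?_
  have hk : Function.update (splitAt k carry S i) index l k = (S k).drop i := by
    simp [splitAt, hki, hkc]
  rw [hk, List.head?_drop, List.tail_drop]
  rcases h : (S k)[i]? with _ | a
  · have hi : (S k).length ≤ i := List.getElem?_eq_none_iff.1 h
    refine (exec_skip (A := Γ') _).congr (congrArg (Prod.mk b) ?_) le_rfl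
    funext j
    by_cases h₁ : j = k <;> by_cases h₂ : j = carry <;> by_cases h₃ : j = index <;>
      simp_all [splitAt, List.take_of_length_le, Nat.le_succ_of_le hi]
  · refine (Exec.push carry _ b _).congr (congrArg (Prod.mk b) ?_) le_rfl
    funext j
    by_cases h₁ : j = k <;> by_cases h₂ : j = carry <;> by_cases h₃ : j = index <;>
      simp_all [splitAt, List.take_add_one]

theorem exec_test (k : K) (b : Bool) (S : K → List Γ') (c : Option Γ') :
    Exec (.pop k fun o => .seq (o.elim skip (.push k)) (.assign fun _ => decide (o = c)))
      (b, S) (decide ((S k).head? = c), S) 3 := by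
  refine .pop (n := 1 + 1) (.seq ?_ (.assign _ b _))
  cases h : S k with
  | nil => exact (exec_skip (A := Γ') _).congr (by simp [h]) le_rfl
  | cons a l => exact (Exec.push k a b _).congr (by simp [h]) le_rfl

theorem exec_readAt (hkc : k ≠ carry) (hki : k ≠ index) (hci : carry ≠ index) (b : Bool)
    (S : K → List Γ') (hS : S carry = []) {e : ℕ} (he : S index = unary e) (c : Option Γ') :
    Exec (readAt k carry index c) (b, S)
      (decide ((S k)[e]? = c), Function.update S index []) (5 * e + 5) := by
  have hck := hkc.symm
  let R := Function.update (splitAt k carry S e) index []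
  have start : Function.update (splitAt k carry S 0) index (unary e ++ []) = S := by
    funext i
    by_cases h₁ : i = k <;> by_cases h₂ : i = carry <;> by_cases h₃ : i = index <;>
      simp_all [splitAt]
  have seek := exec_countDown (fun _ => b) (splitAt k carry S) (n := e) (l := [])
    (fun i _ l => exec_seek hkc hki hci b S i l) (by simp)
  have test := exec_test k b R c
  have back := exec_move hck (decide ((S k)[e]? = c)) R
  rw [start] at seek
  have hk : R k = (S k).drop e := by simp [R, splitAt, hkc, hki]
  rw [hk, List.head?_drop] at test
  refine (seek.seq (test.seq back)).congr (congrArg (Prod.mk _) ?_) ?_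
  · funext i
    by_cases h₁ : i = k <;> by_cases h₂ : i = carry <;> by_cases h₃ : i = index <;>
      simp_all [R, splitAt]
  · simp only [R, splitAt, Nat.reduceAdd, Function.update_of_ne hci, Function.update_self,
      List.length_reverse, List.length_take]
    omega

end Loops

end StackProgram

/-- The working stacks of the programs that evaluate formulas. -/
inductive Scratch : Type
  | control | carry | index | operand | clock | table
  deriving DecidableEq

instance : Fintype Scratch where
  elems := {.control, .carry, .index, .operand, .clock, .table}
  complete s := by cases s <;> decide

namespace StackProgram

open Computability (Γ')

section Terms

variable {J : Type}

/-- The data stacks `S` and the working stacks `T` of a program. -/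
def withScratch (S : J → List Γ') (T : Scratch → List Γ') : J ⊕ Scratch → List Γ' :=
  Sum.elim S T

@[simp]
theorem withScratch_inl (S : J → List Γ') (T j) : withScratch S T (.inl j) = S j := rfl

@[simp]
theorem withScratch_inr (S : J → List Γ') (T j) : withScratch S T (.inr j) = T j := rfl

variable [DecidableEq J]

@[simp]
theorem update_withScratch_inl (S : J → List Γ') (T j l) :
    Function.update (withScratch S T) (.inl j) l = withScratch (Function.update S j l) T :=
  Sum.update_elim_inl

@[simp]
theorem update_withScratch_inr (S : J → List Γ') (T j l) :
    Function.update (withScratch S T) (.inr j) l = withScratch S (Function.update T j l) :=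
  Sum.update_elim_inr

theorem exec_forLength_pushUnary {p : StackProgram (J ⊕ Scratch) Γ'} {k : J} {j : Scratch}
    (hj : j ≠ .control) (hj' : j ≠ .carry) {b : Bool} {S : J → List Γ'} {T : Scratch → List Γ'}
    {e t : ℕ} (hT : T .carry = [])
    (hp : ∀ T', T' .carry = [] → Exec p (b, withScratch S T')
      (b, withScratch S (Function.update T' j (unary e ++ T' j))) t) :
    Exec (forLength (.inl k) (.inr .carry) (.inr .control) p) (b, withScratch S T)
      (b, withScratch S (Function.update T j (unary ((S k).length * e) ++ T j)))
      ((S k).length * (t + 6) + 4) := by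
  let R (i : ℕ) := withScratch S (Function.update T j (unary (i * e) ++ T j))
  have hR : R 0 (.inr .carry) = [] := by simpa [R, hj'.symm] using hT
  have step (i : ℕ) (l : List Γ') : Exec p (b, Function.update (R i) (.inr .control) l)
      (b, Function.update (R (i + 1)) (.inr .control) l) t := by
    have h := hp (Function.update (Function.update T j (unary (i * e) ++ T j)) .control l)
      (by simpa [hj'.symm])
    rw [Function.update_of_ne hj, Function.update_self, Function.update_comm hj.symm,
      Function.update_idem, ← List.append_assoc, ← unary_add, ← Nat.add_comm,
      ← Nat.succ_mul] at h
    simpa only [R, update_withScratch_inr] using h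
  have run := exec_forLength (k := Sum.inl k) (carry := Sum.inr .carry)
    (control := Sum.inr .control) (by simp) (by simp) (by simp)
    (fun _ => b) R hR rfl fun i _ l => step i l
  have start : R 0 = withScratch S T := by simp [R, unary]
  have restored : T .control =
      Function.update T j (unary ((S k).length * e) ++ T j) .control := by
    simp [hj.symm]
  rw [start] at run
  exact run.congr (by simp [R, restored]) le_rfl

theorem exists_exec_pushEval (f : MvPolynomial J ℕ) {j : Scratch} (hj : j ≠ .control)
    (hj' : j ≠ .carry) :
    ∃ (p : StackProgram (J ⊕ Scratch) Γ') (Q : Polynomial ℕ), ∀ N S T b,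
      (∀ k, (S k).length ≤ N) → T .carry = [] →
      Exec p (b, withScratch S T) (b, withScratch S (Function.update T j
        (unary (f.eval fun k => (S k).length) ++ T j))) (Q.eval N) := by
  induction f using MvPolynomial.induction_on with
  | C a =>
    induction a with
    | zero =>
      refine ⟨skip, 1, fun N S T b _ _ => (exec_skip _).congr ?_ (by simp)⟩
      simp [unary]
    | succ a ih =>
      obtain ⟨p, Q, hp⟩ := ih
      refine ⟨.seq p (.push (.inr j) (.bit true)), Q + 1, fun N S T b hN hT =>
        ((hp N S T b hN hT).seq (.push _ _ _ _)).congr ?_ (by simp)⟩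
      simp [unary_succ]
  | add f g hf hg =>
    obtain ⟨p, Q, hp⟩ := hf
    obtain ⟨q, R, hq⟩ := hg
    refine ⟨.seq p q, Q + R, fun N S T b hN hT =>
      ((hp N S T b hN hT).seq (hq N S _ b hN ?_)).congr ?_ (by simp)⟩
    · simpa [hj'.symm] using hT
    · simp [Nat.add_comm (f.eval _), unary_add]
  | mul_X f k hf =>
    obtain ⟨p, Q, hp⟩ := hf
    refine ⟨forLength (.inl k) (.inr .carry) (.inr .control) p, Polynomial.X * (Q + 6) + 4,
      fun N S T b hN hT => ?_⟩
    have run := exec_forLength_pushUnary (k := k) hj hj' hT fun T' hT' => hp N S T' b hN hT'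
    refine run.congr (by simp [Nat.mul_comm]) ?_
    simpa using Nat.mul_le_mul_right (Q.eval N + 6) (hN k)

end Terms

end StackProgram

/-! ### Formulas about words -/

/-- First-order formulas about words over `Γ'` indexed by `K`, with variables in `V` that stand for
natural numbers. Terms are polynomials in the lengths of the words and in the variables;
`symbol k f c` says that `c` is the symbol of the word `k` at the position `f`, where `none` stands
for the positions beyond the end, and `ex v k φ` quantifies over the positions of the word `k`. -/
inductive WordFormula (K V : Type) : Type
  | symbol (k : K) (f : MvPolynomial (K ⊕ V) ℕ) (c : Option Computability.Γ')
  | le (f g : MvPolynomial (K ⊕ V) ℕ)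
  | not (φ : WordFormula K V)
  | and (φ ψ : WordFormula K V)
  | ex (v : V) (k : K) (φ : WordFormula K V)

namespace WordFormula

open Computability (Γ')

section Semantics

variable {K V : Type}

/-- The value of a term. -/
noncomputable def value (f : MvPolynomial (K ⊕ V) ℕ) (w : K → List Γ') (x : V → ℕ) : ℕ :=
  f.eval (Sum.elim (fun k => (w k).length) x)

/-- The truth of a formula about the words `w`, the variables having the values `x`. -/
def Holds [DecidableEq V] : WordFormula K V → (K → List Γ') → (V → ℕ) → Prop
  | symbol k f c, w, x => (w k)[value f w x]? = c
  | le f g, w, x => value f w x ≤ value g w x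
  | not φ, w, x => ¬ φ.Holds w x
  | and φ ψ, w, x => φ.Holds w x ∧ ψ.Holds w x
  | ex v k φ, w, x => ∃ i < (w k).length, φ.Holds w (Function.update x v i)

end Semantics

end WordFormula

namespace StackProgram

open Computability (Γ')

section Formulas

variable {K V : Type}

/-- The data stacks that hold the words `w` and the numbers `x`, the latter in unary, together
with the working stacks `T`. -/
def memory (w : K → List Γ') (x : V → ℕ) (T : Scratch → List Γ') :
    (K ⊕ V) ⊕ Scratch → List Γ' :=
  withScratch (Sum.elim w fun v => unary (x v)) T

@[simp]
theorem memory_word (w : K → List Γ') (x : V → ℕ) (T k) : memory w x T (.inl (.inl k)) = w k := rfl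

@[simp]
theorem memory_var (w : K → List Γ') (x : V → ℕ) (T v) :
    memory w x T (.inl (.inr v)) = unary (x v) := rfl

@[simp]
theorem memory_scratch (w : K → List Γ') (x : V → ℕ) (T j) : memory w x T (.inr j) = T j := rfl

/-- All words have length at most `N`, and all numbers are at most `N`. -/
structure IsBounded (N : ℕ) (w : K → List Γ') (x : V → ℕ) : Prop where
  length_le (k : K) : (w k).length ≤ N
  var_le (v : V) : x v ≤ N

/-- The working stacks that have to be empty when a formula is evaluated are empty. -/
structure IsReady (T : Scratch → List Γ') : Prop where
  carry_eq_nil : T .carry = []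
  index_eq_nil : T .index = []
  operand_eq_nil : T .operand = []

theorem IsBounded.update [DecidableEq V] {N : ℕ} {w : K → List Γ'} {x : V → ℕ}
    (h : IsBounded N w x) {v : V} {n : ℕ} (hn : n ≤ N) :
    IsBounded N w (Function.update x v n) where
  length_le := h.length_le
  var_le u := by
    rcases eq_or_ne u v with rfl | hu
    · simpa using hn
    · simpa [hu] using h.var_le u

theorem IsReady.update_control {T : Scratch → List Γ'} (hT : IsReady T) (l : List Γ') :
    IsReady (Function.update T .control l) where
  carry_eq_nil := by simpa using hT.carry_eq_nil
  index_eq_nil := by simpa using hT.index_eq_nil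
  operand_eq_nil := by simpa using hT.operand_eq_nil

theorem exists_value_le (f : MvPolynomial (K ⊕ V) ℕ) :
    ∃ Q : Polynomial ℕ, ∀ N w x, IsBounded N w x → WordFormula.value f w x ≤ Q.eval N := by
  refine ⟨f.aeval fun _ => Polynomial.X, fun N w x h => ?_⟩
  induction f using MvPolynomial.induction_on with
  | C a => simp [WordFormula.value]
  | add f g hf hg => simpa [WordFormula.value] using Nat.add_le_add hf hg
  | mul_X f j hf =>
    have hj : Sum.elim (fun k => (w k).length) x j ≤ N := by
      cases j
      · exact h.length_le _
      · exact h.var_le _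
    simpa [WordFormula.value] using Nat.mul_le_mul hf hj

variable [DecidableEq K] [DecidableEq V]

@[simp]
theorem update_memory_word (w : K → List Γ') (x : V → ℕ) (T k l) :
    Function.update (memory w x T) (.inl (.inl k)) l = memory (Function.update w k l) x T := by
  simp only [memory, update_withScratch_inl, Sum.update_elim_inl]

@[simp]
theorem update_memory_var (w : K → List Γ') (x : V → ℕ) (T v n) :
    Function.update (memory w x T) (.inl (.inr v)) (unary n) =
      memory w (Function.update x v n) T := by
  simp only [memory, update_withScratch_inl, Sum.update_elim_inr]
  congr 2
  exact (Function.comp_update unary x v n).symm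

@[simp]
theorem update_memory_var_nil (w : K → List Γ') (x : V → ℕ) (T v) :
    Function.update (memory w x T) (.inl (.inr v)) [] = memory w (Function.update x v 0) T :=
  update_memory_var w x T v 0

@[simp]
theorem update_memory_scratch (w : K → List Γ') (x : V → ℕ) (T j l) :
    Function.update (memory w x T) (.inr j) l = memory w x (Function.update T j l) := by
  simp [memory]

theorem exists_exec_pushValue (f : MvPolynomial (K ⊕ V) ℕ) {j : Scratch} (hj : j ≠ .control)
    (hj' : j ≠ .carry) :
    ∃ (p : StackProgram ((K ⊕ V) ⊕ Scratch) Γ') (Q : Polynomial ℕ),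
      ∀ (N : ℕ) (w : K → List Γ') (x : V → ℕ) (T : Scratch → List Γ') (b : Bool),
        IsBounded N w x → T .carry = [] → Exec p (b, memory w x T)
          (b, memory w x (Function.update T j (unary (WordFormula.value f w x) ++ T j)))
          (Q.eval N) := by
  obtain ⟨p, Q, hp⟩ := exists_exec_pushEval f hj hj'
  refine ⟨p, Q, fun N w x T b h hT => ?_⟩
  have run := hp N (Sum.elim w fun v => unary (x v)) T b
    (by simpa using ⟨h.length_le, h.var_le⟩) hT
  have e : (fun k => (Sum.elim w (fun v => unary (x v)) k).length) =
      Sum.elim (fun k => (w k).length) x := by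
    funext j
    cases j <;> simp
  rwa [e] at run

open Classical in
/-- The predicate `P` on words and numbers is decided by a program that leaves its data unchanged,
in time polynomial in a bound on the lengths of the words and on the numbers. -/
def IsPolyTimeEvaluable (P : (K → List Γ') → (V → ℕ) → Prop) : Prop :=
  ∃ (p : StackProgram ((K ⊕ V) ⊕ Scratch) Γ') (Q : Polynomial ℕ), ∀ N w x T b,
    IsBounded N w x → IsReady T → Exec p (b, memory w x T) (decide (P w x), memory w x T) (Q.eval N)

theorem IsPolyTimeEvaluable.symbol (k : K) (f : MvPolynomial (K ⊕ V) ℕ) (c : Option Γ') :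
    IsPolyTimeEvaluable fun (w : K → List Γ') x => (w k)[WordFormula.value f w x]? = c := by
  classical
  obtain ⟨p, Q, hp⟩ := exists_exec_pushValue f (j := .index) (by decide) (by decide)
  obtain ⟨R, hR⟩ := exists_value_le f
  refine ⟨.seq p (readAt (.inl (.inl k)) (.inr .carry) (.inr .index) c), Q + (5 * R + 5),
    fun N w x T b h hT => ?_⟩
  have read := exec_readAt (k := .inl (.inl k)) (carry := .inr .carry) (index := .inr .index)
    (by simp) (by simp) (by simp) b
    (memory w x (Function.update T .index (unary (WordFormula.value f w x) ++ T .index)))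
    (by simpa using hT.carry_eq_nil) (e := WordFormula.value f w x)
    (by simpa using hT.index_eq_nil) c
  refine ((hp N w x T b h hT.carry_eq_nil).seq read).congr ?_ ?_
  · have e : Function.update T .index [] = T := by simp [hT.index_eq_nil]
    exact congrArg₂ Prod.mk (decide_eq_decide.2 (by simp)) (by simp [e])
  · have := hR N w x h
    simp only [Polynomial.eval_add, Polynomial.eval_mul, Polynomial.eval_ofNat]
    omega

theorem IsPolyTimeEvaluable.le (f g : MvPolynomial (K ⊕ V) ℕ) :
    IsPolyTimeEvaluable fun (w : K → List Γ') x =>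
      WordFormula.value f w x ≤ WordFormula.value g w x := by
  classical
  obtain ⟨p, Q, hp⟩ := exists_exec_pushValue f (j := .operand) (by decide) (by decide)
  obtain ⟨q, R, hq⟩ := exists_exec_pushValue g (j := .index) (by decide) (by decide)
  obtain ⟨F, hF⟩ := exists_value_le f
  obtain ⟨G, hG⟩ := exists_value_le g
  refine ⟨.seq p (.seq q (.seq (readAt (.inr .operand) (.inr .carry) (.inr .index) none)
    (clear (.inr .operand)))), Q + (R + (5 * G + 5 + (2 * F + 1))), fun N w x T b h hT => ?_⟩
  let m := WordFormula.value f w x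
  let n := WordFormula.value g w x
  let T₁ := Function.update T .operand (unary m)
  let T₂ := Function.update T₁ .index (unary n)
  have pushF : Exec p (b, memory w x T) (b, memory w x T₁) (Q.eval N) := by
    simpa [hT.operand_eq_nil] using hp N w x T b h hT.carry_eq_nil
  have pushG : Exec q (b, memory w x T₁) (b, memory w x T₂) (R.eval N) := by
    simpa [T₁, hT.index_eq_nil] using hq N w x T₁ b h hT.carry_eq_nil
  have read := exec_readAt (k := .inr .operand) (carry := .inr .carry) (index := .inr .index)
    (by simp) (by simp) (by simp) b (memory w x T₂) (by simpa [T₁, T₂] using hT.carry_eq_nil)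
    (e := n) (by simp [T₂]) none
  have clean := exec_clear (.inr .operand)
    (decide ((memory w x T₂ (.inr .operand))[n]? = none))
    (Function.update (memory w x T₂) (.inr .index) [])
  have restored : Function.update (Function.update T₂ .index []) .operand [] = T := by
    funext j
    cases j <;> simp [T₁, T₂, hT.index_eq_nil, hT.operand_eq_nil]
  refine (pushF.seq (pushG.seq (read.seq clean))).congr ?_ ?_
  · exact congrArg₂ Prod.mk (decide_eq_decide.2 (by simp [T₁, T₂, m, n])) (by simp [restored])
  · have := hF N w x h
    have := hG N w x h
    simp [T₁, T₂]
    omega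

theorem IsPolyTimeEvaluable.not {P : (K → List Γ') → (V → ℕ) → Prop}
    (hP : IsPolyTimeEvaluable P) : IsPolyTimeEvaluable fun w x => ¬ P w x := by
  obtain ⟨p, Q, hp⟩ := hP
  exact ⟨.seq p (.assign Bool.not), Q + 1, fun N w x T b h hT =>
    ((hp N w x T b h hT).seq (.assign _ _ _)).congr (by simp) (by simp)⟩

theorem IsPolyTimeEvaluable.and {P₁ P₂ : (K → List Γ') → (V → ℕ) → Prop}
    (h₁ : IsPolyTimeEvaluable P₁) (h₂ : IsPolyTimeEvaluable P₂) :
    IsPolyTimeEvaluable fun w x => P₁ w x ∧ P₂ w x := by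
  classical
  obtain ⟨p, Q, hp⟩ := h₁
  obtain ⟨q, R, hq⟩ := h₂
  refine ⟨.seq p (.ite q skip), Q + (1 + (R + 1)), fun N w x T b h hT => ?_⟩
  have branch : Exec (bif decide (P₁ w x) then q else skip) (decide (P₁ w x), memory w x T)
      (decide (P₁ w x ∧ P₂ w x), memory w x T) (R.eval N + 1) := by
    by_cases h₁ : P₁ w x
    · simpa [h₁] using (hq N w x T true h hT).mono (Nat.le_succ _)
    · simpa [h₁] using (exec_skip (A := Γ') (false, memory w x T)).mono (by omega)
  exact ((hp N w x T b h hT).seq (.ite branch)).congr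
    (congrArg₂ Prod.mk (decide_eq_decide.2 Iff.rfl) rfl) (by simp)

/-- Run `p` with the variable `v` ranging over the positions of the word `k`. The former value of
the variable is kept on the stack `control`, above a blank, and restored at the end. -/
def forVar (v : V) (k : K) (p : StackProgram ((K ⊕ V) ⊕ Scratch) Γ') :
    StackProgram ((K ⊕ V) ⊕ Scratch) Γ' :=
  .seq (.seq (.push (.inr .control) .blank) (move (.inl (.inr v)) (.inr .control)))
    (.seq (forLength (.inl (.inl k)) (.inr .carry) (.inr .control)
      (.seq p (.push (.inl (.inr v)) (.bit true))))
    (.seq (clear (.inl (.inr v)))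
      (countDown (.inr .control) (.push (.inl (.inr v)) (.bit true)))))

theorem exec_forVar {v : V} {k : K} {p : StackProgram ((K ⊕ V) ⊕ Scratch) Γ'} {N t : ℕ}
    {w : K → List Γ'} {x : V → ℕ} (h : IsBounded N w x) (b : ℕ → Bool)
    (T : ℕ → Scratch → List Γ') (hT : T 0 .carry = [])
    (hp : ∀ i < (w k).length, ∀ l, Exec p
      (b i, memory w (Function.update x v i) (Function.update (T i) .control l))
      (b (i + 1), memory w (Function.update x v i) (Function.update (T (i + 1)) .control l)) t) :
    Exec (forVar v k p) (b 0, memory w x (T 0)) (b (w k).length,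
      memory w x (Function.update (T (w k).length) .control (T 0 .control)))
      (N * (t + 13) + 8) := by
  let n := (w k).length
  let c := unary (x v) ++ .blank :: T 0 .control
  have store := exec_move (k := .inl (.inr v)) (j := .inr .control) (by simp) (b 0)
    (memory w x (Function.update (T 0) .control (.blank :: T 0 .control)))
  have save : Exec (.seq (.push (.inr .control) .blank) (move (.inl (.inr v)) (.inr .control)))
      (b 0, memory w x (T 0))
      (b 0, memory w (Function.update x v 0) (Function.update (T 0) .control c))
      (1 + (2 * x v + 1)) :=
    ((Exec.push _ _ _ _).seq (by simpa using store)).congr (by simp [unary, c]) (by simp)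
  have loop := exec_forLength (k := .inl (.inl k)) (carry := .inr .carry)
    (control := .inr .control) (p := .seq p (.push (.inl (.inr v)) (.bit true)))
    (by simp) (by simp) (by simp) b
    (fun i => memory w (Function.update x v i) (Function.update (T i) .control c)) (n := n)
    (t := t + 1) (by simpa using hT) rfl fun i hi l => by
      have run := (hp i hi l).seq (.push (.inl (.inr v)) (.bit true) _ _)
      simpa [← unary_succ] using run
  have restore := exec_countDown (p := .push (.inl (.inr v)) (.bit true)) (control := .inr .control)
    (n := x v) (t := 1) (fun _ => b n) (fun i => memory w (Function.update x v i) (T n))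
    (l := .blank :: T 0 .control) (fun i _ l => by
      have run := Exec.push (.inl (.inr v)) (.bit true) (b n)
        (memory w (Function.update x v i) (Function.update (T n) .control l))
      simpa [← unary_succ] using run) (by simp)
  have reset := exec_clear (.inl (.inr v)) (b n)
    (memory w (Function.update x v n) (Function.update (T n) .control c))
  simp only [memory_scratch, Function.update_self, update_memory_scratch, Function.update_idem,
    Function.update_eq_self, List.tail_cons, Nat.reduceAdd, update_memory_var_nil, memory_var,
    length_unary] at loop restore reset
  refine (save.seq (loop.seq (reset.seq restore))).mono ?_
  have hx := h.var_le v
  have hn := Nat.mul_le_mul_right (t + 9) (h.length_le k)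
  simp only [n]
  linarith

theorem IsPolyTimeEvaluable.ex (v : V) (k : K) {P : (K → List Γ') → (V → ℕ) → Prop}
    (hP : IsPolyTimeEvaluable P) :
    IsPolyTimeEvaluable fun w x => ∃ i < (w k).length, P w (Function.update x v i) := by
  classical
  obtain ⟨p, Q, hp⟩ := hP
  refine ⟨.seq (.assign fun _ => false) (forVar v k (.ite skip p)),
    1 + (Polynomial.X * (Q + 2 + 13) + 8), fun N w x T b h hT => ?_⟩
  let found (m : ℕ) : Bool := decide (∃ i < m, P w (Function.update x v i))
  have step (i : ℕ) (hi : i < (w k).length) (l : List Γ') : Exec (.ite skip p)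
      (found i, memory w (Function.update x v i) (Function.update T .control l))
      (found (i + 1), memory w (Function.update x v i) (Function.update T .control l))
      (1 + (Q.eval N + 1)) := by
    have split : found (i + 1) = (found i || decide (P w (Function.update x v i))) := by
      simp [found, Nat.le_iff_lt_or_eq, or_and_right, exists_or]
    rw [split]
    refine .ite ?_
    cases found i with
    | true => exact (exec_skip (A := Γ') _).mono (by simp)
    | false =>
      exact (hp N w _ _ false (h.update (hi.le.trans (h.length_le k))) (hT.update_control l)).mono
        (by simp)
  have search := exec_forVar h found (fun _ => T) hT.carry_eq_nil step
  have start : found 0 = false := by simp [found]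
  rw [start, Function.update_eq_self] at search
  refine ((Exec.assign (fun _ => false) b _).seq search).congr ?_ ?_
  · exact congrArg₂ Prod.mk (decide_eq_decide.2 Iff.rfl) rfl
  · simp only [Polynomial.eval_add, Polynomial.eval_mul, Polynomial.eval_X, Polynomial.eval_ofNat,
      Polynomial.eval_one]
    linarith

end Formulas

end StackProgram

namespace WordFormula

open Computability (Γ')

theorem isPolyTimeEvaluable {K V : Type} [DecidableEq K] [DecidableEq V]
    (φ : WordFormula K V) :
    StackProgram.IsPolyTimeEvaluable φ.Holds := by
  induction φ with
  | symbol k f c => exact .symbol k f c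
  | le f g => exact .le f g
  | not φ hφ => exact hφ.not
  | and φ ψ hφ hψ => exact hφ.and hψ
  | ex v k φ hφ => exact hφ.ex v k

section Tables

variable {K V : Type} [DecidableEq V]

open Classical in
/-- The truth values of the formula `φ`, the variables of the list `vs` ranging over the positions
of the word `k`, in lexicographic order. -/
noncomputable def table (k : K) (φ : WordFormula K V) (w : K → List Γ') :
    List V → (V → ℕ) → List Γ'
  | [], x => [.bit (decide (φ.Holds w x))]
  | v :: vs, x => (List.range (w k).length).flatMap fun i => table k φ w vs (Function.update x v i)

/-- One round of an inductive definition over words: the table of `φ` becomes the word `r`. -/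
noncomputable def refill [DecidableEq K] (k r : K) (φ : WordFormula K V) (vs : List V) (x : V → ℕ)
    (w : K → List Γ') : K → List Γ' :=
  Function.update w r (table k φ w vs x)

theorem length_table (k : K) (φ : WordFormula K V) (w : K → List Γ') (vs : List V) (x : V → ℕ) :
    (table k φ w vs x).length = (w k).length ^ vs.length := by
  induction vs generalizing x with
  | nil => simp [table]
  | cons v vs ih => simp [table, ih, pow_succ']

theorem iterate_refill_of_ne [DecidableEq K] {k r j : K} (hj : j ≠ r) (φ : WordFormula K V)
    (vs : List V) (x : V → ℕ) (w : K → List Γ') (i : ℕ) : (refill k r φ vs x)^[i] w j = w j := by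
  induction i with
  | zero => rfl
  | succ i ih => rwa [Function.iterate_succ_apply', refill, Function.update_of_ne hj]

end Tables

end WordFormula

namespace StackProgram

open Computability (Γ')

open WordFormula

section Tables

variable {K V : Type}

theorem IsReady.update_table {T : Scratch → List Γ'} (hT : IsReady T) (l : List Γ') :
    IsReady (Function.update T .table l) where
  carry_eq_nil := by simpa using hT.carry_eq_nil
  index_eq_nil := by simpa using hT.index_eq_nil
  operand_eq_nil := by simpa using hT.operand_eq_nil

theorem IsReady.update_clock {T : Scratch → List Γ'} (hT : IsReady T) (l : List Γ') :
    IsReady (Function.update T .clock l) where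
  carry_eq_nil := by simpa using hT.carry_eq_nil
  index_eq_nil := by simpa using hT.index_eq_nil
  operand_eq_nil := by simpa using hT.operand_eq_nil

variable [DecidableEq K] [DecidableEq V]

theorem IsBounded.iterate_refill {N : ℕ} {w : K → List Γ'} {x : V → ℕ} (h : IsBounded N w x)
    {k r : K} (hkr : k ≠ r) (φ : WordFormula K V) (vs : List V) (i : ℕ) :
    IsBounded (N + N ^ vs.length) ((refill k r φ vs x)^[i] w) x where
  length_le j := by
    rcases eq_or_ne j r with rfl | hj
    · cases i with
      | zero => exact (h.length_le j).trans (Nat.le_add_right _ _)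
      | succ i =>
        rw [Function.iterate_succ_apply', refill, Function.update_self, length_table,
          iterate_refill_of_ne hkr]
        exact (Nat.pow_le_pow_left (h.length_le k) _).trans (Nat.le_add_left _ _)
    · rw [iterate_refill_of_ne hj]
      exact (h.length_le j).trans (Nat.le_add_right _ _)
  var_le v := (h.var_le v).trans (Nat.le_add_right _ _)

open Classical in
theorem exists_exec_pushHolds (φ : WordFormula K V) :
    ∃ (p : StackProgram ((K ⊕ V) ⊕ Scratch) Γ') (Q : Polynomial ℕ), ∀ N w x T b,
      IsBounded N w x → IsReady T → Exec p (b, memory w x T)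
        (false, memory w x (Function.update T .table
          (.bit (decide (φ.Holds w x)) :: T .table))) (Q.eval N) := by
  obtain ⟨p, Q, hp⟩ := φ.isPolyTimeEvaluable
  let push (b : Bool) : StackProgram ((K ⊕ V) ⊕ Scratch) Γ' := .push (.inr .table) (.bit b)
  refine ⟨.seq (.seq p (.ite (push true) (push false))) (.assign fun _ => false), Q + 2 + 1,
    fun N w x T b h hT => ?_⟩
  have record : Exec (bif decide (φ.Holds w x) then push true else push false)
      (decide (φ.Holds w x), memory w x T) (decide (φ.Holds w x), memory w x
        (Function.update T .table (.bit (decide (φ.Holds w x)) :: T .table))) 1 := by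
    cases decide (φ.Holds w x) <;> exact (Exec.push _ _ _ _).congr (by simp) le_rfl
  exact (((hp N w x T b h hT).seq (.ite record)).seq (.assign _ _ _)).congr rfl (by simp)

open Classical in
theorem exists_exec_pushTable (k : K) (φ : WordFormula K V) (vs : List V) :
    ∃ (p : StackProgram ((K ⊕ V) ⊕ Scratch) Γ') (Q : Polynomial ℕ), ∀ N w x T b,
      IsBounded N w x → IsReady T → Exec p (b, memory w x T)
        (false, memory w x (Function.update T .table ((table k φ w vs x).reverse ++ T .table)))
        (Q.eval N) := by
  classical
  induction vs with
  | nil =>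
    obtain ⟨p, Q, hp⟩ := exists_exec_pushHolds φ
    exact ⟨p, Q, fun N w x T b h hT => by simpa [table] using hp N w x T b h hT⟩
  | cons v vs ih =>
    obtain ⟨p, Q, hp⟩ := ih
    refine ⟨.seq (.assign fun _ => false) (forVar v k p), 1 + (Polynomial.X * (Q + 13) + 8),
      fun N w x T b h hT => ?_⟩
    let rows (i : ℕ) := (List.range i).flatMap fun i => table k φ w vs (Function.update x v i)
    let R (i : ℕ) := Function.update T .table ((rows i).reverse ++ T .table)
    have step (i : ℕ) (hi : i < (w k).length) (l : List Γ') : Exec p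
        (false, memory w (Function.update x v i) (Function.update (R i) .control l))
        (false, memory w (Function.update x v i) (Function.update (R (i + 1)) .control l))
        (Q.eval N) := by
      have row := hp N w _ (Function.update (R i) .control l) false
        (h.update (v := v) (hi.le.trans (h.length_le k))) ((hT.update_table _).update_control l)
      have append : Function.update (Function.update (R i) .control l) .table
          ((table k φ w vs (Function.update x v i)).reverse ++
            Function.update (R i) .control l .table) = Function.update (R (i + 1)) .control l := by
        funext j
        cases j <;> simp [R, rows, List.range_succ]
      rwa [append] at row
    have fill := exec_forVar h (fun _ => false) R (hT.update_table _).carry_eq_nil step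
    have start : R 0 = T := by simp [R, rows]
    have restored : Function.update (R (w k).length) .control (T .control) = R (w k).length := by
      simp [R]
    rw [start, restored] at fill
    refine ((Exec.assign (fun _ => false) b _).seq fill).congr (by simp only [R, rows, table]) ?_
    simp

theorem exists_exec_refill (k r : K) (φ : WordFormula K V) (vs : List V) :
    ∃ (p : StackProgram ((K ⊕ V) ⊕ Scratch) Γ') (Q : Polynomial ℕ), ∀ N w x T b,
      IsBounded N w x → IsReady T → T .table = [] →
      Exec p (b, memory w x T) (false, memory (refill k r φ vs x w) x T) (Q.eval N) := by
  obtain ⟨p, Q, hp⟩ := exists_exec_pushTable k φ vs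
  refine ⟨.seq p (.seq (clear (.inl (.inl r))) (move (.inr .table) (.inl (.inl r)))),
    Q + ((2 * Polynomial.X + 1) + (2 * Polynomial.X ^ vs.length + 1)),
    fun N w x T b h hT hT' => ?_⟩
  have fill := hp N w x T b h hT
  rw [hT', List.append_nil] at fill
  have empty := exec_clear (.inl (.inl r)) false
    (memory w x (Function.update T .table (table k φ w vs x).reverse))
  rw [update_memory_word] at empty
  have copy := exec_move (k := .inr .table) (j := .inl (.inl r)) (by simp) false
    (memory (Function.update w r []) x (Function.update T .table (table k φ w vs x).reverse))
  have emptied : Function.update T .table [] = T := by simp [hT']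
  refine (fill.seq (empty.seq copy)).congr (by simp [refill, emptied]) ?_
  have hr := h.length_le r
  have ht := Nat.pow_le_pow_left (h.length_le k) vs.length
  simp only [memory_word, memory_scratch, Function.update_self, List.length_reverse, length_table,
    Polynomial.eval_add, Polynomial.eval_mul, Polynomial.eval_pow, Polynomial.eval_X,
    Polynomial.eval_ofNat, Polynomial.eval_one]
  omega

theorem exists_exec_iterate_refill {k r : K} (hkr : k ≠ r) (φ : WordFormula K V) (vs : List V)
    (f : MvPolynomial (K ⊕ V) ℕ) :
    ∃ (p : StackProgram ((K ⊕ V) ⊕ Scratch) Γ') (Q : Polynomial ℕ), ∀ N w x T,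
      IsBounded N w x → IsReady T → T .table = [] → T .clock = [] →
      Exec p (false, memory w x T)
        (false, memory ((refill k r φ vs x)^[value f w x] w) x T) (Q.eval N) := by
  obtain ⟨p, P, hp⟩ := exists_exec_pushValue f (j := .clock) (by decide) (by decide)
  obtain ⟨q, Q, hq⟩ := exists_exec_refill k r φ vs
  obtain ⟨F, hF⟩ := exists_value_le f
  refine ⟨.seq p (countDown (.inr .clock) q),
    P + (F * (Q.comp (Polynomial.X + Polynomial.X ^ vs.length) + 1) + 1),
    fun N w x T h hT hT' hT'' => ?_⟩
  have start := hp N w x T false h hT.carry_eq_nil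
  have loop := exec_countDown (p := q) (control := .inr .clock) (n := value f w x)
    (t := Q.eval (N + N ^ vs.length)) (l := []) (fun _ => false)
    (fun i => memory ((refill k r φ vs x)^[i] w) x T) (fun i _ l => by
      have round := hq _ _ _ (Function.update T .clock l) false (h.iterate_refill hkr φ vs i)
        (hT.update_clock l) (by simpa using hT')
      simpa only [update_memory_scratch, Function.iterate_succ_apply'] using round) (by simp)
  simp only [update_memory_scratch, List.append_nil, Function.iterate_zero_apply,
    List.tail_nil] at loop
  rw [hT'', List.append_nil] at start
  have emptied : Function.update T .clock [] = T := by simp [hT'']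
  refine (start.seq (emptied ▸ loop)).mono ?_
  simp only [Polynomial.eval_add, Polynomial.eval_mul, Polynomial.eval_comp, Polynomial.eval_pow,
    Polynomial.eval_X, Polynomial.eval_one]
  gcongr
  exact hF N w x h

end Tables

end StackProgram

theorem index_lt {m n x y : ℕ} (hx : x < m) (hy : y < n) : x * n + y < m * n := by
  have := Nat.mul_le_mul_right n (Nat.succ_le_of_lt hx)
  rw [Nat.succ_mul] at this
  omega

theorem getElem?_flatMap_of_length_eq {α β : Type*} {f : α → List β} {n : ℕ}
    (hf : ∀ a, (f a).length = n) (l : List α) (i : ℕ) {j : ℕ} (hj : j < n) :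
    (l.flatMap f)[i * n + j]? = l[i]?.bind fun a => (f a)[j]? := by
  induction l generalizing i with
  | nil => simp
  | cons a l ih =>
    rw [List.flatMap_cons]
    cases i with
    | zero => simp [List.getElem?_append_left (hj.trans_eq (hf a).symm)]
    | succ i =>
      rw [Nat.succ_mul, Nat.add_right_comm, Nat.add_comm _ n,
        List.getElem?_append_right (by rw [hf]; omega), hf, Nat.add_sub_cancel_left, ih,
        List.getElem?_cons_succ]

namespace WordFormula

open Computability (Γ')

variable {K V : Type} [DecidableEq V]

theorem getElem?_table_cons {k : K} {φ : WordFormula K V} {w : K → List Γ'} {v : V} {vs : List V}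
    {x : V → ℕ} {i j : ℕ} (hi : i < (w k).length) (hj : j < (w k).length ^ vs.length) :
    (table k φ w (v :: vs) x)[i * (w k).length ^ vs.length + j]? =
      (table k φ w vs (Function.update x v i))[j]? := by
  rw [table, getElem?_flatMap_of_length_eq (fun _ => length_table _ _ _ _ _) _ _ hj]
  simp [hi]

end WordFormula

namespace StackProgram

open Computability (Γ')

open WordFormula

variable {K V : Type}

theorem memory_nil : memory (fun _ : K => []) (0 : V → ℕ) (fun _ => []) = fun _ => [] := by
  funext j
  rcases j with (_ | _) | _ <;> rfl

variable [DecidableEq K] [DecidableEq V]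

open Classical in
theorem exists_exec_inductive {k r : K} (hkr : k ≠ r) (ψ : WordFormula K V) (vs : List V)
    (f : MvPolynomial (K ⊕ V) ℕ) (φ : WordFormula K V) :
    ∃ (p : StackProgram ((K ⊕ V) ⊕ Scratch) Γ') (Q : Polynomial ℕ), ∀ w, (∀ j ≠ k, w j = []) →
      Exec p (false, memory w 0 fun _ => [])
        (decide (φ.Holds ((refill k r ψ vs 0)^[value f w 0] w) 0), fun _ => [])
        (Q.eval (w k).length) := by
  obtain ⟨p, P, hp⟩ := exists_exec_iterate_refill hkr ψ vs f
  obtain ⟨q, Q, hq⟩ := φ.isPolyTimeEvaluable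
  let B : Polynomial ℕ := Polynomial.X + Polynomial.X ^ vs.length
  refine ⟨.seq p (.seq q (.seq (clear (.inl (.inl k))) (clear (.inl (.inl r))))),
    P + (Q.comp B + ((2 * B + 1) + (2 * B + 1))), fun w hw => ?_⟩
  have bounded : IsBounded (w k).length w (0 : V → ℕ) :=
    { length_le j := by by_cases hj : j = k <;> simp [hj, hw]
      var_le _ := Nat.zero_le _ }
  have ready : IsReady fun _ => [] := ⟨rfl, rfl, rfl⟩
  let w' := (refill k r ψ vs 0)^[value f w 0] w
  have bounded' : IsBounded (B.eval (w k).length) w' (0 : V → ℕ) := by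
    simpa [B] using bounded.iterate_refill hkr ψ vs (value f w 0)
  have iterate := hp _ w 0 _ bounded ready rfl rfl
  have evaluate := hq _ w' 0 _ false bounded' ready
  have clearInput := exec_clear (.inl (.inl k)) (decide (φ.Holds w' 0))
    (memory w' (0 : V → ℕ) fun _ => [])
  have clearTable := exec_clear (.inl (.inl r)) (decide (φ.Holds w' 0))
    (memory (Function.update w' k []) (0 : V → ℕ) fun _ => [])
  have emptied : Function.update (Function.update w' k []) r [] = fun _ => [] := by
    funext j
    by_cases hr : j = r
    · simp [hr]
    · by_cases hk : j = k <;> simp [hr, hk, w', hw, iterate_refill_of_ne, hkr]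
  simp only [update_memory_word, memory_word, Function.update_of_ne hkr.symm]
    at clearInput clearTable
  rw [emptied, memory_nil] at clearTable
  refine (iterate.seq (evaluate.seq (clearInput.seq clearTable))).mono ?_
  have hk := bounded'.length_le k
  have hr := bounded'.length_le r
  simp only [Polynomial.eval_add, Polynomial.eval_mul, Polynomial.eval_comp, Polynomial.eval_ofNat,
    Polynomial.eval_one]
  omega

end StackProgram

namespace WordFormula

open Computability (Γ')

theorem decidableInPolyTime {K V α : Type} [DecidableEq K] [DecidableEq V] [Finite K] [Finite V]
    (enc : α → List Γ') (P : α → Prop) {k r : K} (hkr : k ≠ r) (ψ : WordFormula K V) (vs : List V)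
    (f : MvPolynomial (K ⊕ V) ℕ) (φ : WordFormula K V)
    (h : ∀ a w, w k = enc a → (∀ j ≠ k, w j = []) →
      (P a ↔ φ.Holds ((refill k r ψ vs 0)^[value f w 0] w) 0)) : DecidableInPolyTime enc P := by
  classical
  obtain ⟨p, Q, hp⟩ := StackProgram.exists_exec_inductive hkr ψ vs f φ
  refine StackProgram.decidableInPolyTime enc P p (.inl (.inl k)) Q fun a => ?_
  let w := Function.update (fun _ => []) k (enc a)
  have hw : w k = enc a := Function.update_self _ _ _
  have hw' (j : K) (hj : j ≠ k) : w j = [] := Function.update_of_ne hj _ _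
  have run := hp w hw'
  rw [hw] at run
  rw [← StackProgram.memory_nil, StackProgram.update_memory_word]
  exact run.congr (congrArg₂ Prod.mk (decide_eq_decide.2 (h a w hw hw').symm)
    StackProgram.memory_nil.symm) le_rfl

end WordFormula

/-! ### Orderings with prescribed intervals -/

section Intervals

variable {C : Type} {𝓕 : Set (Set C)}

/-- The members of `𝓕` are intervals of the strict total order `lt`: no element outside of a member
lies between two elements of it. -/
def AreIntervals (lt : C → C → Prop) (𝓕 : Set (Set C)) : Prop :=
  ∀ S ∈ 𝓕, ∀ a ∈ S, ∀ b ∈ S, ∀ c ∉ S, lt a c → lt b c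

/-- In an ordering in which all members of `𝓕` are intervals, two elements of a member `S` are on
the same side of any element outside `S`: the order of the pair `p` determines that of `q`. -/
def ForcingStep (𝓕 : Set (Set C)) (p q : C × C) : Prop :=
  ∃ S ∈ 𝓕, ∃ a ∈ S, ∃ b ∈ S, ∃ c ∉ S, (p = (a, c) ∧ q = (b, c)) ∨ (p = (c, a) ∧ q = (c, b))

/-- The order of the pair `p` determines that of `q` by a chain of forcing steps. -/
def Linked (𝓕 : Set (Set C)) : C × C → C × C → Prop :=
  Relation.ReflTransGen (ForcingStep 𝓕)

theorem ForcingStep.symm {p q : C × C} (h : ForcingStep 𝓕 p q) : ForcingStep 𝓕 q p := by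
  obtain ⟨S, hS, a, ha, b, hb, c, hc, h⟩ := h
  exact ⟨S, hS, b, hb, a, ha, c, hc, h.imp And.symm And.symm⟩

theorem ForcingStep.swap {p q : C × C} (h : ForcingStep 𝓕 p q) :
    ForcingStep 𝓕 p.swap q.swap := by
  obtain ⟨S, hS, a, ha, b, hb, c, hc, ⟨rfl, rfl⟩ | ⟨rfl, rfl⟩⟩ := h
  · exact ⟨S, hS, a, ha, b, hb, c, hc, .inr ⟨rfl, rfl⟩⟩
  · exact ⟨S, hS, a, ha, b, hb, c, hc, .inl ⟨rfl, rfl⟩⟩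

theorem forcingStep_left {S : Set C} (hS : S ∈ 𝓕) {a b c : C} (ha : a ∈ S) (hb : b ∈ S)
    (hc : c ∉ S) : ForcingStep 𝓕 (a, c) (b, c) :=
  ⟨S, hS, a, ha, b, hb, c, hc, .inl ⟨rfl, rfl⟩⟩

theorem forcingStep_right {S : Set C} (hS : S ∈ 𝓕) {a b c : C} (ha : a ∈ S) (hb : b ∈ S)
    (hc : c ∉ S) : ForcingStep 𝓕 (c, a) (c, b) :=
  (forcingStep_left hS ha hb hc).swap

theorem Linked.symm {p q : C × C} (h : Linked 𝓕 p q) : Linked 𝓕 q p :=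
  haveI : Std.Symm (ForcingStep 𝓕) := ⟨fun _ _ => ForcingStep.symm⟩
  (Relation.ReflTransGen.stdSymm).symm _ _ h

theorem Linked.trans {p q r : C × C} (h : Linked 𝓕 p q) (h' : Linked 𝓕 q r) : Linked 𝓕 p r :=
  Relation.ReflTransGen.trans h h'

theorem Linked.swap {p q : C × C} (h : Linked 𝓕 p q) : Linked 𝓕 p.swap q.swap :=
  Relation.ReflTransGen.lift Prod.swap (fun _ _ => ForcingStep.swap) _ _ h

theorem Linked.ne {p q : C × C} (h : Linked 𝓕 p q) (hp : p.1 ≠ p.2) : q.1 ≠ q.2 := by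
  induction h with
  | refl => exact hp
  | tail _ h _ =>
    obtain ⟨S, _, a, _, b, hb, c, hc, ⟨rfl, rfl⟩ | ⟨rfl, rfl⟩⟩ := h
    · exact (ne_of_mem_of_not_mem hb hc :)
    · exact (ne_of_mem_of_not_mem hb hc).symm

section StrictTotalOrder

variable {lt : C → C → Prop} [IsStrictTotalOrder C lt]

theorem AreIntervals.lt_of_forcingStep (h : AreIntervals lt 𝓕) {p q : C × C}
    (hpq : ForcingStep 𝓕 p q) (hp : lt p.1 p.2) : lt q.1 q.2 := by
  obtain ⟨S, hS, a, ha, b, hb, c, hc, ⟨rfl, rfl⟩ | ⟨rfl, rfl⟩⟩ := hpq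
  · exact h S hS a ha b hb c hc hp
  · rcases trichotomous_of lt c b with hcb | rfl | hbc
    · exact hcb
    · exact absurd hb hc
    · exact absurd (h S hS b hb a ha c hc hbc) (asymm_of lt hp)

theorem AreIntervals.lt_of_linked (h : AreIntervals lt 𝓕) {p q : C × C} (hpq : Linked 𝓕 p q)
    (hp : lt p.1 p.2) : lt q.1 q.2 := by
  induction hpq with
  | refl => exact hp
  | tail _ h' ih => exact h.lt_of_forcingStep h' ih

theorem AreIntervals.not_linked_swap (h : AreIntervals lt 𝓕) {p : C × C} (hp : p.1 ≠ p.2) :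
    ¬ Linked 𝓕 p p.swap := fun hl => by
  rcases trichotomous_of lt p.1 p.2 with h' | h' | h'
  · exact asymm_of lt h' (h.lt_of_linked hl h')
  · exact hp h'
  · exact asymm_of lt h' (h.lt_of_linked hl.symm h')

end StrictTotalOrder

/-- The analogue of the triangle lemma on the implication classes of a comparability graph. -/
theorem Linked.triangle {a b c : C} (h₁ : ¬ Linked 𝓕 (b, c) (a, c)) (h₂ : ¬ Linked 𝓕 (b, c) (b, a))
    {q : C × C} (h : Linked 𝓕 (b, c) q) :
    a ≠ q.1 ∧ a ≠ q.2 ∧ Linked 𝓕 (a, b) (a, q.1) ∧ Linked 𝓕 (a, c) (a, q.2) := by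
  induction h with
  | refl =>
    refine ⟨?_, ?_, .refl, .refl⟩
    · rintro rfl; exact h₁ .refl
    · rintro rfl; exact h₂ .refl
  | tail hq h ih =>
    obtain ⟨S, hS, x, hx, y, hy, z, hz, ⟨rfl, rfl⟩ | ⟨rfl, rfl⟩⟩ := h
    · obtain ⟨_, hne, l₁, l₂⟩ := ih
      have ha : a ∉ S := fun ha =>
        h₁ ((hq.tail (forcingStep_left hS hx ha hz)).trans l₂.symm)
      exact ⟨fun e => ha (e ▸ hy), hne, l₁.tail (forcingStep_right hS hx hy ha), l₂⟩
    · obtain ⟨hne, _, l₁, l₂⟩ := ih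
      have ha : a ∉ S := fun ha =>
        h₂ ((hq.tail (forcingStep_right hS hx ha hz)).trans l₁.symm.swap)
      exact ⟨hne, fun e => ha (e ▸ hy), l₁, l₂.tail (forcingStep_right hS hx hy ha)⟩

variable [LinearOrder C]

/-- `q` is linked to `p`, and it is the lexicographically least increasing pair linked to `p` or
to the reverse of `p`. -/
structure IsLeastLinked (𝓕 : Set (Set C)) (p q : C × C) : Prop where
  lt : q.1 < q.2
  linked : Linked 𝓕 p q
  le {r : C × C} (hr : r.1 < r.2) (h : Linked 𝓕 p r ∨ Linked 𝓕 p r.swap) : toLex q ≤ toLex r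

/-- Orient each class of linked pairs so that its least increasing pair keeps its order. -/
def LexOriented (𝓕 : Set (Set C)) (p : C × C) : Prop := ∃ q, IsLeastLinked 𝓕 p q

theorem IsLeastLinked.congr {p p' q : C × C} (h : IsLeastLinked 𝓕 p q) (hp : Linked 𝓕 p p') :
    IsLeastLinked 𝓕 p' q where
  lt := h.lt
  linked := hp.symm.trans h.linked
  le hr h' := h.le hr (h'.imp hp.trans hp.trans)

theorem LexOriented.congr {p p' : C × C} (h : LexOriented 𝓕 p) (hp : Linked 𝓕 p p') :
    LexOriented 𝓕 p' :=
  h.imp fun _ h => h.congr hp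

theorem lexOriented_or_swap [WellFoundedLT C] {p : C × C} (hp : p.1 ≠ p.2) :
    LexOriented 𝓕 p ∨ LexOriented 𝓕 p.swap := by
  have nonempty : {r : C ×ₗ C | (ofLex r).1 < (ofLex r).2 ∧
      (Linked 𝓕 p (ofLex r) ∨ Linked 𝓕 p (ofLex r).swap)}.Nonempty := by
    rcases lt_or_gt_of_ne hp with h | h
    · exact ⟨toLex p, h, .inl .refl⟩
    · exact ⟨toLex p.swap, h, .inr .refl⟩
  obtain ⟨q, ⟨hq, hl⟩, hmin⟩ :=
    WellFounded.has_min (wellFounded_lt (α := C ×ₗ C)) _ nonempty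
  have least {r : C × C} (hr : r.1 < r.2) (h : Linked 𝓕 p r ∨ Linked 𝓕 p r.swap) : q ≤ toLex r :=
    not_lt.1 (hmin (toLex r) ⟨hr, h⟩)
  rcases hl with hl | hl
  · exact .inl ⟨ofLex q, hq, hl, least⟩
  · exact .inr ⟨ofLex q, hq, hl.swap, fun hr h => least hr (h.symm.imp Linked.swap Linked.swap)⟩

section Orientation

variable (h𝓕 : ∀ p : C × C, p.1 ≠ p.2 → ¬ Linked 𝓕 p p.swap)

include h𝓕

theorem LexOriented.not_swap {p : C × C} (h : LexOriented 𝓕 p) : ¬ LexOriented 𝓕 p.swap := by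
  rintro ⟨q', hq'⟩
  obtain ⟨q, hq⟩ := h
  have e : toLex q = toLex q' := le_antisymm
    (hq.le hq'.lt (.inr hq'.linked.swap)) (hq'.le hq.lt (.inr hq.linked.swap))
  obtain rfl : q = q' := e
  exact h𝓕 p (hq.linked.symm.ne hq.lt.ne) (hq.linked.trans hq'.linked.symm)

theorem LexOriented.not_linked {p q : C × C} (hp : LexOriented 𝓕 p) (hq : LexOriented 𝓕 q.swap) :
    ¬ Linked 𝓕 p q :=
  fun h => (hp.congr h).not_swap h𝓕 hq

theorem LexOriented.not_cyclic_of_le {a b c : C} {p q : C × C} (hp : IsLeastLinked 𝓕 (a, b) p)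
    (hq : IsLeastLinked 𝓕 (b, c) q) (hca : LexOriented 𝓕 (c, a)) (hqp : toLex q ≤ toLex p) :
    False := by
  have hab : LexOriented 𝓕 (a, b) := ⟨p, hp⟩
  have hbc : LexOriented 𝓕 (b, c) := ⟨q, hq⟩
  -- The triangle lemma replaces `(b, c)` by the least pair `(b₀, c₀)` linked to it.
  obtain ⟨hne, -, l₁, l₂⟩ := Linked.triangle (hbc.not_linked h𝓕 (q := (a, c)) hca)
    (hbc.not_linked h𝓕 (q := (b, a)) hab) hq.linked
  obtain ⟨b₀, c₀⟩ := q
  dsimp only at hne l₁ l₂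
  have hp' := hp.congr l₁
  have hca' := hca.congr l₂.swap
  have hbp : b₀ ≤ p.1 := Prod.Lex.monotone_fst _ _ hqp
  have hba : b₀ < a := hne.lt_or_gt.resolve_left fun h =>
    (hbp.trans (Prod.Lex.monotone_fst _ _ (hp'.le (r := (a, b₀)) h (.inl .refl)))).not_gt h
  have hpb : p.1 = b₀ :=
    le_antisymm (Prod.Lex.monotone_fst _ _ (hp'.le (r := (b₀, a)) hba (.inr .refl))) hbp
  have l := (Linked.triangle
    ((hab.congr l₁).not_linked h𝓕 (q := (c₀, b₀)) (hbc.congr hq.linked))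
    ((hab.congr l₁).not_linked h𝓕 (q := (a, c₀)) hca') hp'.linked).2.2.1
  rw [hpb] at l
  exact hca'.not_linked h𝓕 (q := (c₀, b₀)) (hbc.congr hq.linked) l

theorem LexOriented.not_cyclic {a b c : C} (hab : LexOriented 𝓕 (a, b))
    (hbc : LexOriented 𝓕 (b, c)) (hca : LexOriented 𝓕 (c, a)) : False := by
  obtain ⟨p, hp⟩ := id hab
  obtain ⟨q, hq⟩ := id hbc
  obtain ⟨r, hr⟩ := id hca
  rcases le_or_gt (toLex q) (toLex p) with h₁ | h₁
  · exact not_cyclic_of_le h𝓕 hp hq hca h₁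
  rcases le_or_gt (toLex r) (toLex q) with h₂ | h₂
  · exact not_cyclic_of_le h𝓕 hq hr hab h₂
  exact not_cyclic_of_le h𝓕 hr hp hbc (h₁.trans h₂).le

theorem isStrictTotalOrder_lexOriented [WellFoundedLT C] :
    IsStrictTotalOrder C fun a b => LexOriented 𝓕 (a, b) where
  irrefl a h := h.not_swap h𝓕 h
  trichotomous a b h₁ h₂ := by
    by_contra hne
    exact (lexOriented_or_swap (p := (a, b)) hne).elim h₁ h₂
  trans a b c hab hbc := by
    have hac : a ≠ c := by
      rintro rfl
      exact hab.not_swap h𝓕 hbc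
    exact (lexOriented_or_swap (p := (a, c)) hac).resolve_right
      fun hca => LexOriented.not_cyclic h𝓕 hab hbc hca

end Orientation

theorem exists_areIntervals_iff [WellFoundedLT C] (𝓕 : Set (Set C)) :
    (∃ lt : C → C → Prop, IsStrictTotalOrder C lt ∧ AreIntervals lt 𝓕) ↔
      ∀ p : C × C, p.1 ≠ p.2 → ¬ Linked 𝓕 p p.swap :=
  ⟨fun ⟨_, _, h⟩ _ hp => h.not_linked_swap hp,
    fun h => ⟨_, isStrictTotalOrder_lexOriented h, fun _ hS _ ha _ hb _ hc hac =>
      hac.congr (.single (forcingStep_left hS ha hb hc))⟩⟩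

end Intervals

namespace Axis

variable {C : Type} {L : Axis C}

open Classical in
/-- `a` is to the left of `b` on the axis. -/
def lt (L : Axis C) (a b : C) : Prop := L.order.idxOf a < L.order.idxOf b

instance (L : Axis C) : IsStrictTotalOrder C L.lt where
  irrefl _ := lt_irrefl _
  trichotomous a _ h₁ h₂ := by
    classical exact (List.idxOf_inj (L.complete a)).1 (le_antisymm (not_lt.1 h₂) (not_lt.1 h₁))
  trans _ _ _ h₁ h₂ := lt_trans h₁ h₂

theorem pairwise_iff {R : C → C → Prop} : L.order.Pairwise R ↔ ∀ a b, L.lt a b → R a b := by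
  classical
  rw [List.pairwise_iff_getElem]
  constructor
  · intro h a b hab
    simpa using h _ _ (List.idxOf_lt_length_of_mem (L.complete a))
      (List.idxOf_lt_length_of_mem (L.complete b)) hab
  · intro h i j hi hj hij
    refine h _ _ ?_
    simpa [lt, List.Nodup.idxOf_getElem L.nodup] using hij

theorem exists_lt_eq [Finite C] (lt : C → C → Prop) [IsStrictTotalOrder C lt] :
    ∃ L : Axis C, L.lt = lt := by
  classical
  have := Fintype.ofFinite C
  let _ : LinearOrder C := linearOrderOfSTO lt
  let L : Axis C := ⟨Finset.univ.sort (· ≤ ·), Finset.sort_nodup _ _, by simp⟩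
  have sorted (a b : C) (h : L.lt a b) : lt a b :=
    pairwise_iff.1 (Finset.sortedLT_sort (Finset.univ : Finset C)).pairwise a b h
  refine ⟨L, funext₂ fun a b => propext ⟨sorted a b, fun h => ?_⟩⟩
  rcases trichotomous_of L.lt a b with hab | rfl | hba
  · exact hab
  · exact absurd h (irrefl_of lt a)
  · exact absurd (sorted b a hba) (asymm_of lt h)

end Axis

/-! ### Single-peakedness as an interval condition -/

namespace WeakOrder

variable {C : Type} {v : WeakOrder C} {a b c p : C} {L : Axis C}

/-- No candidate is worse than `a`. -/
def IsBottom (v : WeakOrder C) (a : C) : Prop := ∀ e, v.rel e a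

/-- `p` is the unique most preferred candidate. -/
def IsTop (v : WeakOrder C) (p : C) : Prop := ∀ c, c ≠ p → v.Prefers p c

/-- Candidate `c` is better than `a`, or both are at the bottom. -/
def PrefersOrBottom (v : WeakOrder C) (c a : C) : Prop :=
  v.Prefers c a ∨ v.IsBottom c ∧ v.IsBottom a

/-- The sets of candidates that are intervals of each axis with respect to which the vote is
single-peaked with outside options: for each `d` the candidates at least as good as `d`, and, if
`d` is not at the bottom, `d` together with the candidates better than `d`. -/
def intervals (v : WeakOrder C) : Set (Set C) :=
  {S | ∃ d, S = {x | v.rel x d} ∨ (∃ e, v.Prefers d e) ∧ S = {x | v.Prefers x d ∨ x = d}}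

/-- Along the ordering `lt`, the candidates get better towards `p`, except at the bottom. -/
def IncreasesTo (v : WeakOrder C) (lt : C → C → Prop) (p : C) : Prop :=
  ∀ x y, lt x y ∧ lt y p ∨ lt p y ∧ lt y x → v.PrefersOrBottom y x

theorem refl (v : WeakOrder C) (a : C) : v.rel a a := (v.complete a a).elim id id

theorem Prefers.trans_rel (h : v.Prefers a b) (h' : v.rel b c) : v.Prefers a c :=
  ⟨v.transitive _ _ _ h.1 h', fun h'' => h.2 (v.transitive _ _ _ h' h'')⟩

theorem Prefers.rel_trans (h' : v.rel a b) (h : v.Prefers b c) : v.Prefers a c :=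
  ⟨v.transitive _ _ _ h' h.1, fun h'' => h.2 (v.transitive _ _ _ h'' h')⟩

theorem not_rel : ¬ v.rel a b ↔ v.Prefers b a :=
  ⟨fun h => ⟨(v.complete a b).resolve_left h, h⟩, fun h => h.2⟩

theorem not_isBottom : ¬ v.IsBottom a ↔ ∃ e, v.Prefers a e := by
  simp only [IsBottom, not_forall, not_rel]

theorem Prefers.not_isBottom (h : v.Prefers a b) : ¬ v.IsBottom a := fun h' => h.2 (h' b)

instance : IsTrans C fun a b => v.Prefers a b := ⟨fun _ _ _ h h' => h.trans_rel h'.1⟩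

instance : IsTrans C fun a b => v.Prefers b a := ⟨fun _ _ _ h h' => h'.trans_rel h.1⟩

theorem PrefersOrBottom.mem {S : Set C} (hS : S ∈ v.intervals) (h : v.PrefersOrBottom c a)
    (ha : a ∈ S) : c ∈ S := by
  obtain ⟨d, rfl | ⟨⟨e, he⟩, rfl⟩⟩ := hS
  · exact v.transitive _ _ _ (h.elim And.left fun h => h.2 c) ha
  · have had : v.rel a d := ha.elim And.left fun e => e ▸ v.refl a
    rcases h with h | ⟨-, h⟩
    · exact .inl (h.trans_rel had)
    · exact absurd h (Prefers.rel_trans had he).not_isBottom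

theorem IsTop.mem (hp : v.IsTop p) {S : Set C} (hS : S ∈ v.intervals) (ha : a ∈ S) : p ∈ S := by
  by_cases h : a = p
  · exact h ▸ ha
  · exact PrefersOrBottom.mem hS (.inl (hp a h)) ha

theorem exists_mem_intervals (h : ¬ v.PrefersOrBottom b a) (hab : a ≠ b) :
    ∃ S ∈ v.intervals, a ∈ S ∧ b ∉ S := by
  simp only [PrefersOrBottom, not_or, not_and] at h
  by_cases hba : v.rel b a
  · have hrel : v.rel a b := by_contra fun h' => h.1 ⟨hba, h'⟩
    have ha : ¬ v.IsBottom a := fun ha => h.2 (fun e => v.transitive _ _ _ (ha e) hrel) ha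
    exact ⟨{x | v.Prefers x a ∨ x = a}, ⟨a, .inr ⟨not_isBottom.1 ha, rfl⟩⟩, .inr rfl,
      not_or.2 ⟨h.1, hab.symm⟩⟩
  · exact ⟨{x | v.rel x a}, ⟨a, .inl rfl⟩, v.refl a, hba⟩

theorem IsTop.areIntervals_iff (hp : v.IsTop p) {lt : C → C → Prop} [IsStrictTotalOrder C lt] :
    AreIntervals lt v.intervals ↔ v.IncreasesTo lt p := by
  constructor
  · intro h x y hxy
    have hne : x ≠ y := by
      rintro rfl
      exact hxy.elim (fun h => irrefl_of lt x h.1) fun h => irrefl_of lt x h.2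
    by_contra hn
    obtain ⟨S, hS, hx, hy⟩ := exists_mem_intervals hn hne
    rcases hxy with ⟨hxy, hyp⟩ | ⟨hpy, hyx⟩
    · exact asymm_of lt hyp (h S hS x hx p (hp.mem hS hx) y hy hxy)
    · exact asymm_of lt hyx (h S hS p (hp.mem hS hx) x hx y hy hpy)
  · intro h S hS a ha b hb c hc hac
    by_contra hbc
    have hcb : lt c b :=
      ((trichotomous_of lt b c).resolve_left hbc).resolve_left fun e => hc (e ▸ hb)
    rcases trichotomous_of lt c p with hcp | rfl | hpc
    · exact hc ((h a c (.inl ⟨hac, hcp⟩)).mem hS ha)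
    · exact hc (hp.mem hS ha)
    · exact hc ((h b c (.inr ⟨hpc, hcb⟩)).mem hS hb)

theorem increasesTo_iff_pairwise {l₁ l₂ : List C} (hL : L.order = l₁ ++ p :: l₂) :
    v.IncreasesTo L.lt p ↔ l₁.Pairwise (fun x y => v.PrefersOrBottom y x) ∧
      l₂.Pairwise fun x y => v.PrefersOrBottom x y := by
  have ordered : L.order.Pairwise L.lt := Axis.pairwise_iff.2 fun _ _ => id
  rw [hL, List.pairwise_append, List.pairwise_cons] at ordered
  obtain ⟨h₁, ⟨hp₂, h₂⟩, h₁₂⟩ := ordered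
  have hp₁ (x : C) (hx : x ∈ l₁) : L.lt x p := h₁₂ x hx p List.mem_cons_self
  constructor
  · exact fun h => ⟨h₁.imp_of_mem fun _ hy hxy => h _ _ (.inl ⟨hxy, hp₁ _ hy⟩),
      h₂.imp_of_mem fun hx _ hxy => h _ _ (.inr ⟨hp₂ _ hx, hxy⟩)⟩
  · rintro ⟨hl₁, hl₂⟩
    have improves : L.order.Pairwise fun x y =>
        (L.lt y p → v.PrefersOrBottom y x) ∧ (L.lt p x → v.PrefersOrBottom x y) := by
      rw [hL, List.pairwise_append, List.pairwise_cons]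
      refine ⟨hl₁.imp_of_mem fun hx _ h => ⟨fun _ => h, fun h' => ?_⟩,
        ⟨fun y hy => ⟨fun h' => ?_, fun h' => ?_⟩,
          hl₂.imp_of_mem fun _ hy h => ⟨fun h' => ?_, fun _ => h⟩⟩, fun x hx y hy =>
        ⟨fun h' => ?_, fun h' => ?_⟩⟩
      · exact absurd h' (asymm_of L.lt (hp₁ _ hx))
      · exact absurd h' (asymm_of L.lt (hp₂ _ hy))
      · exact absurd h' (irrefl_of L.lt p)
      · exact absurd h' (asymm_of L.lt (hp₂ _ hy))
      · rcases List.mem_cons.1 hy with rfl | hy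
        · exact absurd h' (irrefl_of L.lt y)
        · exact absurd h' (asymm_of L.lt (hp₂ _ hy))
      · exact absurd h' (asymm_of L.lt (hp₁ _ hx))
    rintro x y (⟨hxy, hyp⟩ | ⟨hpy, hyx⟩)
    · exact (Axis.pairwise_iff.1 improves x y hxy).1 hyp
    · exact (Axis.pairwise_iff.1 improves y x hyx).2 hpy

theorem exists_append_of_pairwise (l : List C)
    (h : l.Pairwise fun a b => v.PrefersOrBottom b a) :
    ∃ O X, l = O ++ X ∧ (∀ a ∈ O, v.IsBottom a) ∧ (∀ a ∈ X, ¬ v.IsBottom a) ∧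
      X.Pairwise fun a b => v.Prefers b a := by
  induction l with
  | nil => exact ⟨[], [], by simp⟩
  | cons a l ih =>
    rw [List.pairwise_cons] at h
    by_cases ha : v.IsBottom a
    · obtain ⟨O, X, rfl, hO, hX, hX'⟩ := ih h.2
      exact ⟨a :: O, X, rfl, by simpa [ha] using hO, hX, hX'⟩
    · have h' (b : C) (hb : b ∈ l) : v.Prefers b a := (h.1 b hb).resolve_right fun h => ha h.2
      refine ⟨[], a :: l, rfl, by simp, ?_, ?_⟩
      · simpa [ha] using fun b hb => (h' b hb).not_isBottom
      · exact List.pairwise_cons.2 ⟨h', h.2.imp_of_mem fun hb _ hbc =>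
          hbc.resolve_right fun h => (h' _ hb).not_isBottom h.2⟩

theorem isSinglePeakedWithOutsideOptions_of_increasesTo (hp : v.IsTop p)
    (h : v.IncreasesTo L.lt p) : v.IsSinglePeakedWithOutsideOptions L := by
  obtain ⟨l₁, l₂, hL⟩ := List.append_of_mem (L.complete p)
  obtain ⟨h₁, h₂⟩ := (increasesTo_iff_pairwise hL).1 h
  obtain ⟨O₁, X, rfl, hO₁, hX, hX'⟩ := exists_append_of_pairwise l₁ h₁
  obtain ⟨O₂, Z, hl₂, hO₂, hZ, hZ'⟩ :=
    exists_append_of_pairwise l₂.reverse (List.pairwise_reverse.2 h₂)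
  obtain rfl : l₂ = Z.reverse ++ O₂.reverse := by
    rw [← List.reverse_append, ← hl₂, List.reverse_reverse]
  have bottom (b : C) (hb : b ∈ O₁ ++ O₂.reverse) : v.IsBottom b := by
    rw [List.mem_append, List.mem_reverse] at hb
    exact hb.elim (hO₁ b) (hO₂ b)
  refine ⟨O₁, X, p, Z.reverse, O₂.reverse, by simp [hL], hp, List.isChain_iff_pairwise.2 hX',
    List.isChain_iff_pairwise.2 (List.pairwise_reverse.2 hZ'), fun a ha b hb => ?_,
    fun x hx y hy => ⟨bottom y hy x, bottom x hx y⟩⟩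
  by_cases hap : a = p
  · refine hap ▸ hp b ?_
    rintro rfl
    have nodup := hL ▸ L.nodup
    grind
  · have hab : ¬ v.IsBottom a := by
      simp only [List.mem_append, List.mem_singleton, hap, or_false, List.mem_reverse] at ha
      exact ha.elim (hX a) (hZ a)
    obtain ⟨e, he⟩ := not_isBottom.1 hab
    exact he.trans_rel (bottom b hb e)

theorem IsSinglePeakedWithOutsideOptions.exists_increasesTo
    (h : v.IsSinglePeakedWithOutsideOptions L) : ∃ p, v.IsTop p ∧ v.IncreasesTo L.lt p := by
  obtain ⟨O₁, X, p, Z, O₂, hL, hp, hX, hZ, hXO, hO⟩ := h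
  have bottom (x : C) (hx : x ∈ O₁ ++ O₂) : v.IsBottom x := fun e => by
    have he := L.complete e
    rw [hL] at he
    by_cases heO : e ∈ O₁ ++ O₂
    · exact (hO e heO x hx).1
    · exact (hXO e (by grind) x hx).1
  have hL' : L.order = (O₁ ++ X) ++ p :: (Z ++ O₂) := by simp [hL]
  refine ⟨p, hp, (increasesTo_iff_pairwise hL').2 ⟨?_, ?_⟩⟩ <;> rw [List.pairwise_append]
  · exact ⟨List.pairwise_of_forall_mem_list fun x hx y hy =>
        .inr ⟨bottom y (by simp [hy]), bottom x (by simp [hx])⟩,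
      (List.isChain_iff_pairwise.1 hX).imp .inl,
      fun x hx y hy => .inl (hXO y (by simp [hy]) x (by simp [hx]))⟩
  · exact ⟨(List.isChain_iff_pairwise.1 hZ).imp .inl,
      List.pairwise_of_forall_mem_list fun x hx y hy =>
        .inr ⟨bottom x (by simp [hx]), bottom y (by simp [hy])⟩,
      fun x hx y hy => .inl (hXO x (by simp [hx]) y (by simp [hy]))⟩

theorem isSinglePeakedWithOutsideOptions_iff :
    v.IsSinglePeakedWithOutsideOptions L ↔
      (∃ p, v.IsTop p) ∧ AreIntervals L.lt v.intervals := by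
  constructor
  · intro h
    obtain ⟨p, hp, hL⟩ := h.exists_increasesTo
    exact ⟨⟨p, hp⟩, hp.areIntervals_iff.2 hL⟩
  · rintro ⟨⟨p, hp⟩, hL⟩
    exact isSinglePeakedWithOutsideOptions_of_increasesTo hp (hp.areIntervals_iff.1 hL)

end WeakOrder

namespace Profile

/-- The sets of candidates that are intervals of each axis with respect to which the profile is
single-peaked with outside options. -/
def intervals (V : Profile) : Set (Set (Fin V.numCandidates)) :=
  {S | ∃ v ∈ V.votes, S ∈ v.intervals}

theorem isSinglePeakedWithOutsideOptions_iff {V : Profile} {L : Axis (Fin V.numCandidates)} :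
    V.IsSinglePeakedWithOutsideOptions L ↔
      (∀ v ∈ V.votes, ∃ p, v.IsTop p) ∧ AreIntervals L.lt V.intervals := by
  simp only [IsSinglePeakedWithOutsideOptions, WeakOrder.isSinglePeakedWithOutsideOptions_iff,
    AreIntervals, intervals, Set.mem_ofPred_eq]
  grind

theorem exists_axis_iff (V : Profile) :
    (∃ L : Axis (Fin V.numCandidates), V.IsSinglePeakedWithOutsideOptions L) ↔
      (∀ v ∈ V.votes, ∃ p, v.IsTop p) ∧
        ∀ q : Fin V.numCandidates × Fin V.numCandidates, q.1 ≠ q.2 →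
          ¬ Linked V.intervals q q.swap := by
  simp only [isSinglePeakedWithOutsideOptions_iff, exists_and_left, ← exists_areIntervals_iff]
  refine and_congr_right fun _ => ⟨fun ⟨L, hL⟩ => ⟨L.lt, inferInstance, hL⟩, ?_⟩
  rintro ⟨lt, _, hlt⟩
  obtain ⟨L, rfl⟩ := Axis.exists_lt_eq lt
  exact ⟨L, hlt⟩

end Profile

/-! ### Stages of a transitive closure -/

section Stages

variable {α : Type*} {E : α → α → Prop} {p : α} {S : ℕ → Set α}

theorem monotone_of_stages (zero : S 0 = ∅)
    (succ : ∀ i, S (i + 1) = {q | p = q ∨ ∃ r ∈ S i, E r q}) : Monotone S := by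
  refine monotone_nat_of_le_succ fun i => ?_
  induction i with
  | zero => simp [zero]
  | succ i ih =>
    rw [succ i, succ (i + 1)]
    exact fun q => Or.imp_right fun ⟨r, hr, hrq⟩ => ⟨r, ih hr, hrq⟩

theorem stages_eq_reflTransGen [Finite α] (zero : S 0 = ∅)
    (succ : ∀ i, S (i + 1) = {q | p = q ∨ ∃ r ∈ S i, E r q}) {N : ℕ} (hN : Nat.card α ≤ N) :
    S N = {q | Relation.ReflTransGen E p q} := by
  have mono := monotone_of_stages zero succ
  have card_mono : Monotone fun i => (S i).ncard := fun i j h => Set.ncard_le_ncard (mono h)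
  have stable (i : ℕ) (h : (S i).ncard = (S (i + 1)).ncard) :
      (S (i + 1)).ncard = (S (i + 2)).ncard := by
    rw [succ i, succ (i + 1), Set.eq_of_subset_of_ncard_le (mono i.le_succ) h.ge]
  have card_eq {n : ℕ} (hn : N ≤ n) : (S n).ncard = (S (Nat.card α)).ncard :=
    Nat.stabilises_of_monotone card_mono (fun i => Set.ncard_le_card (S i)) stable (hN.trans hn)
  have fixed : S N = S (N + 1) := Set.eq_of_subset_of_ncard_le (mono N.le_succ)
    ((card_eq N.le_succ).trans (card_eq le_rfl).symm).le
  refine Set.Subset.antisymm ?_ fun q hq => ?_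
  · clear hN card_eq fixed
    induction N with
    | zero => simp [zero]
    | succ i ih =>
      rw [succ]
      rintro q (rfl | ⟨r, hr, hrq⟩)
      · exact .refl
      · exact .tail (ih hr) hrq
  · rw [fixed, succ]
    induction hq with
    | refl => exact .inl rfl
    | tail _ hrq ih =>
      refine .inr ⟨_, ?_, hrq⟩
      rw [fixed, succ]
      exact ih

end Stages

/-! ### Formulas about the encodings of profiles -/

namespace WeakOrder

theorem getElem?_encode_zero {m : ℕ} (v : WeakOrder (Fin m)) : v.encode[0]? = some .bra := rfl

theorem getElem?_encode_rel {m : ℕ} (v : WeakOrder (Fin m)) (a b : Fin m) :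
    v.encode[1 + (a * (m + 1) + b)]? = some (.bit true) ↔ v.rel a b := by
  have hlt := index_lt a.2 (b.2.trans (Nat.lt_add_one m))
  rw [encode, List.append_assoc, List.getElem?_append_right (by simp), List.length_singleton,
    Nat.add_sub_cancel_left, List.ofFn_eq_map, ← List.flatMap_def, List.getElem?_append_left,
    getElem?_flatMap_of_length_eq (n := m + 1) (by simp) _ _ (by omega)]
  · simp
  · simpa [List.length_flatMap] using hlt

end WeakOrder

namespace Profile

variable (V : Profile)

theorem getElem?_encode_size {i : ℕ} (hi : i ≤ V.numCandidates) :
    V.encode[i]? = some .comma ↔ i = V.numCandidates := by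
  rw [encode, List.getElem?_append_left (by simpa using Nat.lt_succ_of_le hi)]
  obtain rfl | h := hi.eq_or_lt
  · simp
  · simp [List.getElem?_append_left, h, h.ne]

theorem numCandidates_lt_length_encode : V.numCandidates < V.encode.length := by
  simp [encode]

theorem getElem?_encode (t : ℕ) {j : ℕ}
    (hj : j < V.numCandidates * (V.numCandidates + 1) + 2) :
    V.encode[V.numCandidates + 1 +
        (t * (V.numCandidates * (V.numCandidates + 1) + 2) + j)]? =
      V.votes[t]?.bind fun v => v.encode[j]? := by
  rw [encode, List.getElem?_append_right (by simp), List.length_append, List.length_replicate,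
    List.length_singleton, Nat.add_sub_cancel_left,
    getElem?_flatMap_of_length_eq WeakOrder.length_encode _ _ hj]

theorem getElem?_encode_rel {t : ℕ} {v : WeakOrder (Fin V.numCandidates)}
    (hv : V.votes[t]? = some v) (a b : Fin V.numCandidates) :
    V.encode[V.numCandidates + 1 + (t * (V.numCandidates * (V.numCandidates + 1) + 2) +
      (1 + (a * (V.numCandidates + 1) + b)))]? = some (.bit true) ↔ v.rel a b := by
  have hlt := index_lt a.2 (b.2.trans (Nat.lt_add_one _))
  rw [V.getElem?_encode t (by omega), hv, Option.bind_some, v.getElem?_encode_rel]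

theorem getElem?_encode_vote (t : ℕ) :
    V.encode[V.numCandidates + 1 + t * (V.numCandidates * (V.numCandidates + 1) + 2)]? =
      some .bra ↔ ∃ v, V.votes[t]? = some v := by
  rw [← Nat.add_zero (t * _), V.getElem?_encode t (by omega)]
  cases V.votes[t]? <;> simp [WeakOrder.getElem?_encode_zero]

theorem exists_mem_intervals_iff {P : Set (Fin V.numCandidates) → Prop} :
    (∃ A ∈ V.intervals, P A) ↔
      ∃ (t : ℕ) (v : WeakOrder (Fin V.numCandidates)), V.votes[t]? = some v ∧ ∃ d,
        P {c | v.rel c d} ∨ (∃ e, v.Prefers d e) ∧ P {c | v.Prefers c d ∨ c = d} := by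
  constructor
  · rintro ⟨_, ⟨v, hv, d, rfl | ⟨he, rfl⟩⟩, hA⟩
    all_goals obtain ⟨t, ht⟩ := List.getElem?_of_mem hv
    · exact ⟨t, v, ht, d, .inl hA⟩
    · exact ⟨t, v, ht, d, .inr ⟨he, hA⟩⟩
  · rintro ⟨t, v, ht, d, hA | ⟨he, hA⟩⟩
    · exact ⟨_, ⟨v, List.mem_of_getElem? ht, d, .inl rfl⟩, hA⟩
    · exact ⟨_, ⟨v, List.mem_of_getElem? ht, d, .inr ⟨he, rfl⟩⟩, hA⟩

end Profile

namespace WordFormula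

section Connectives

variable {K V : Type}

/-- The term whose value is the variable `v`. -/
noncomputable def var (v : V) : MvPolynomial (K ⊕ V) ℕ := .X (.inr v)

/-- The term whose value is the length of the word `k`. -/
noncomputable def length (k : K) : MvPolynomial (K ⊕ V) ℕ := .X (.inl k)

/-- The equality of two terms. -/
def eq (f g : MvPolynomial (K ⊕ V) ℕ) : WordFormula K V := .and (.le f g) (.le g f)

/-- The strict order of two terms. -/
def lt (f g : MvPolynomial (K ⊕ V) ℕ) : WordFormula K V := .not (.le g f)

/-- The disjunction of two formulas. -/
protected def or (φ ψ : WordFormula K V) : WordFormula K V := .not (.and (.not φ) (.not ψ))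

variable (f g : MvPolynomial (K ⊕ V) ℕ) (φ ψ : WordFormula K V) (w : K → List Computability.Γ')
  (x : V → ℕ)

@[simp]
theorem value_var (v : V) : value (K := K) (var v) w x = x v := MvPolynomial.eval_X _

@[simp]
theorem value_length (k : K) : value (V := V) (length k) w x = (w k).length := MvPolynomial.eval_X _

@[simp]
theorem value_add : value (f + g) w x = value f w x + value g w x := map_add _ _ _

@[simp]
theorem value_mul : value (f * g) w x = value f w x * value g w x := map_mul _ _ _

@[simp]
theorem value_pow (n : ℕ) : value (f ^ n) w x = value f w x ^ n := map_pow _ _ _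

@[simp]
theorem value_one : value (1 : MvPolynomial (K ⊕ V) ℕ) w x = 1 := map_one _

@[simp]
theorem value_two : value (2 : MvPolynomial (K ⊕ V) ℕ) w x = 2 := map_ofNat _ 2

variable [DecidableEq V]

@[simp]
theorem holds_symbol (k : K) (c) : (symbol k f c).Holds w x ↔ (w k)[value f w x]? = c := Iff.rfl

@[simp]
theorem holds_not : (WordFormula.not φ).Holds w x ↔ ¬ φ.Holds w x := Iff.rfl

@[simp]
theorem holds_and : (WordFormula.and φ ψ).Holds w x ↔ φ.Holds w x ∧ ψ.Holds w x := Iff.rfl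

@[simp]
theorem holds_ex (v : V) (k : K) :
    (ex v k φ).Holds w x ↔ ∃ i < (w k).length, φ.Holds w (Function.update x v i) := Iff.rfl

@[simp]
theorem holds_or : (WordFormula.or φ ψ).Holds w x ↔ φ.Holds w x ∨ ψ.Holds w x :=
  or_iff_not_and_not.symm

@[simp]
theorem holds_eq : (eq f g).Holds w x ↔ value f w x = value g w x := antisymm_iff

@[simp]
theorem holds_lt : (lt f g).Holds w x ↔ value f w x < value g w x := not_le

end Connectives

end WordFormula

/-- The words that the formulas about profiles talk about: the encoding of a profile, and the table
of the pairs of pairs of candidates that have been found to be linked. -/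
inductive ProfileWord : Type
  | input
  | table
  deriving DecidableEq

instance : Fintype ProfileWord where
  elems := {.input, .table}
  complete k := by cases k <;> decide

/-- The variables of the formulas about profiles: the number of candidates, an auxiliary position,
the number of a vote, and candidates. -/
inductive ProfileVar : Type
  | size
  | position
  | vote
  | cut
  | worse
  | source₁
  | source₂
  | middle₁
  | middle₂
  | target₁
  | target₂
  deriving DecidableEq

instance : Fintype ProfileVar where
  elems := {.size, .position, .vote, .cut, .worse, .source₁, .source₂, .middle₁, .middle₂, .target₁,
    .target₂}
  complete v := by cases v <;> decide

/-- First-order formulas about the encodings of profiles. -/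
abbrev ProfileFormula : Type := WordFormula ProfileWord ProfileVar

namespace ProfileFormula

open Computability (Γ')
open WordFormula ProfileVar

/-- The formula `φ`, the variable `size` having the number of candidates as its value: this is the
position of the first comma of the encoding. -/
noncomputable def withSize (φ : ProfileFormula) : ProfileFormula :=
  .ex size .input <| .and (.symbol .input (var size) (some .comma)) <|
    .and (.not <| .ex position .input <|
      .and (lt (var position) (var size)) (.symbol .input (var position) (some .comma))) φ

/-- Some candidate `u` satisfies `φ`. -/
noncomputable def exCandidate (u : ProfileVar) (φ : ProfileFormula) : ProfileFormula :=
  .ex u .input (.and (lt (var u) (var size)) φ)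

/-- All candidates `u` satisfy `φ`. -/
noncomputable def allCandidates (u : ProfileVar) (φ : ProfileFormula) : ProfileFormula :=
  .not (exCandidate u (.not φ))

/-- The position at which the encoding of the vote `vote` begins. -/
noncomputable def voteStart : MvPolynomial (ProfileWord ⊕ ProfileVar) ℕ :=
  var size + 1 + var vote * (var size * (var size + 1) + 2)

/-- Some vote satisfies `φ`. -/
noncomputable def exVote (φ : ProfileFormula) : ProfileFormula :=
  .ex vote .input (.and (.symbol .input voteStart (some .bra)) φ)

/-- The candidate `a` is at least as good as `b` according to the vote `vote`. -/
noncomputable def rel (a b : ProfileVar) : ProfileFormula :=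
  .symbol .input (voteStart + (1 + (var a * (var size + 1) + var b))) (some (.bit true))

/-- The candidate `a` is preferred to `b` according to the vote `vote`. -/
noncomputable def prefers (a b : ProfileVar) : ProfileFormula :=
  .and (rel a b) (.not (rel b a))

/-- The forcing step from the pair `middle` to the pair `target` by means of the set `S`. -/
noncomputable def stepBy (S : ProfileVar → ProfileFormula) : ProfileFormula :=
  .or
    (.and (.and (S middle₁) (S target₁)) (.and (.not (S middle₂)) (eq (var middle₂) (var target₂))))
    (.and (.and (S middle₂) (S target₂)) (.and (.not (S middle₁)) (eq (var middle₁) (var target₁))))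

/-- The forcing step from the pair `middle` to the pair `target`. -/
noncomputable def step : ProfileFormula :=
  exVote <| exCandidate cut <| .or (stepBy fun u => rel u cut) <|
    .and (exCandidate worse (prefers cut worse)) <|
      stepBy fun u => .or (prefers u cut) (eq (var u) (var cut))

/-- The position in `table` of the entry for the pairs `(a, b)` and `(c, d)`. -/
noncomputable def entry (a b c d : ProfileVar) : MvPolynomial (ProfileWord ⊕ ProfileVar) ℕ :=
  var a * length .input ^ 3 +
    (var b * length .input ^ 2 + (var c * length .input + var d))

/-- The pairs `(a, b)` and `(c, d)` have been found to be linked. -/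
noncomputable def linked (a b c d : ProfileVar) : ProfileFormula :=
  .symbol .table (entry a b c d) (some (.bit true))

/-- The pair `target` is `source` or arises by a forcing step from a pair that has been found to be
linked to `source`. -/
noncomputable def linkedNext : ProfileFormula :=
  withSize <| .or (.and (eq (var source₁) (var target₁)) (eq (var source₂) (var target₂))) <|
    exCandidate middle₁ <| exCandidate middle₂ <|
      .and (linked source₁ source₂ middle₁ middle₂) step

/-- One round of the search for linked pairs: `table` receives the truth values of `linkedNext`. -/
noncomputable abbrev searchRound : (ProfileWord → List Γ') → ProfileWord → List Γ' :=
  refill .input .table linkedNext [source₁, source₂, target₁, target₂] 0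

/-- Every vote has a top candidate. -/
noncomputable def haveTop : ProfileFormula :=
  .not <| exVote <| .not <| exCandidate cut <| allCandidates worse <|
    .or (eq (var worse) (var cut)) (prefers cut worse)

/-- No pair of distinct candidates has been found to be linked to its reverse. -/
noncomputable def noneLinkedToSwap : ProfileFormula :=
  allCandidates source₁ <| allCandidates source₂ <|
    .or (eq (var source₁) (var source₂)) (.not (linked source₁ source₂ source₂ source₁))

/-- Every vote has a top candidate, and no pair has been found to be linked to its reverse: once the
search is complete, this says that the profile has an axis. -/
noncomputable def existsAxis : ProfileFormula := withSize (.and haveTop noneLinkedToSwap)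

/-- The variables and words describe the profile `V`. -/
structure Reads (V : Profile) (w : ProfileWord → List Γ') (x : ProfileVar → ℕ) : Prop where
  input_eq : w .input = V.encode
  size_eq : x size = V.numCandidates

section Semantics

variable {V : Profile} {w : ProfileWord → List Γ'} {x : ProfileVar → ℕ} {φ : ProfileFormula}

theorem Reads.update (h : Reads V w x) {u : ProfileVar} (hu : u ≠ size) (i : ℕ) :
    Reads V w (Function.update x u i) where
  input_eq := h.input_eq
  size_eq := by rw [Function.update_of_ne hu.symm, h.size_eq]

theorem reads_update_size (hw : w .input = V.encode) :
    Reads V w (Function.update x size V.numCandidates) where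
  input_eq := hw
  size_eq := Function.update_self _ _ _

theorem holds_withSize (hw : w .input = V.encode) :
    (withSize φ).Holds w x ↔ φ.Holds w (Function.update x size V.numCandidates) := by
  have hlt := V.numCandidates_lt_length_encode
  have isSize {m : ℕ} (hm : V.encode[m]? = some .comma)
      (h : ¬ ∃ i < V.encode.length, i < m ∧ V.encode[i]? = some .comma) :
      m = V.numCandidates := by
    refine (V.getElem?_encode_size (not_lt.1 fun hlt' => h ⟨_, hlt, hlt', ?_⟩)).1 hm
    exact (V.getElem?_encode_size le_rfl).2 rfl
  simp only [withSize, holds_ex, holds_and, holds_not, holds_symbol, holds_lt, value_var, hw,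
    Function.update_self, ne_eq, reduceCtorEq, not_false_eq_true, Function.update_of_ne]
  constructor
  · rintro ⟨m, -, hm, hfirst, hφ⟩
    rwa [isSize hm hfirst] at hφ
  · refine fun hφ => ⟨_, hlt, (V.getElem?_encode_size le_rfl).2 rfl, ?_, hφ⟩
    rintro ⟨i, -, hi, hcomma⟩
    exact hi.ne ((V.getElem?_encode_size hi.le).1 hcomma)

theorem holds_exCandidate (h : Reads V w x) {u : ProfileVar} (hu : u ≠ size) :
    (exCandidate u φ).Holds w x ↔
      ∃ a : Fin V.numCandidates, φ.Holds w (Function.update x u a) := by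
  have hlt := V.numCandidates_lt_length_encode
  simp only [exCandidate, holds_ex, holds_and, holds_lt, value_var, Function.update_self,
    Function.update_of_ne hu.symm, h.size_eq, h.input_eq]
  exact ⟨fun ⟨a, _, ha, hφ⟩ => ⟨⟨a, ha⟩, hφ⟩, fun ⟨a, hφ⟩ => ⟨a, a.2.trans hlt, a.2, hφ⟩⟩

theorem holds_allCandidates (h : Reads V w x) {u : ProfileVar} (hu : u ≠ size) :
    (allCandidates u φ).Holds w x ↔
      ∀ a : Fin V.numCandidates, φ.Holds w (Function.update x u a) := by
  simp only [allCandidates, holds_not, holds_exCandidate h hu, not_exists, not_not]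

theorem holds_exVote (h : Reads V w x) :
    (exVote φ).Holds w x ↔
      ∃ t v, V.votes[t]? = some v ∧ φ.Holds w (Function.update x vote t) := by
  simp only [exVote, holds_ex, holds_and, holds_symbol, voteStart, value_add, value_mul, value_var,
    value_one, value_two, Function.update_self, ne_eq, reduceCtorEq, not_false_eq_true,
    Function.update_of_ne, h.size_eq, h.input_eq, V.getElem?_encode_vote]
  constructor
  · rintro ⟨t, -, ⟨v, hv⟩, hφ⟩
    exact ⟨t, v, hv, hφ⟩
  · rintro ⟨t, v, hv, hφ⟩
    obtain ⟨hlt, -⟩ := List.getElem?_eq_some_iff.1 ((V.getElem?_encode_vote t).2 ⟨v, hv⟩)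
    have := Nat.le_mul_of_pos_right t
      (Nat.zero_lt_succ (V.numCandidates * (V.numCandidates + 1) + 1))
    simp only [Nat.succ_eq_add_one, Nat.add_assoc, Nat.reduceAdd] at this hlt
    exact ⟨t, by omega, ⟨v, hv⟩, hφ⟩

variable {v : WeakOrder (Fin V.numCandidates)} {a b : Fin V.numCandidates} {u u' : ProfileVar}

theorem holds_rel (h : Reads V w x) (hv : V.votes[x vote]? = some v) (ha : x u = a)
    (hb : x u' = b) : (rel u u').Holds w x ↔ v.rel a b := by
  simp only [rel, holds_symbol, voteStart, value_add, value_mul, value_var, value_one, value_two,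
    h.size_eq, h.input_eq, ha, hb]
  rw [Nat.add_assoc, V.getElem?_encode_rel hv]

theorem holds_prefers (h : Reads V w x) (hv : V.votes[x vote]? = some v) (ha : x u = a)
    (hb : x u' = b) : (prefers u u').Holds w x ↔ v.Prefers a b :=
  and_congr (holds_rel h hv ha hb) (not_congr (holds_rel h hv hb ha))

theorem holds_eq_var (ha : x u = a) (hb : x u' = b) :
    (eq (var u) (var u')).Holds w x ↔ a = b := by
  rw [holds_eq, value_var, value_var, ha, hb, Fin.val_inj]

/-- The pairs that `table` lists as linked to the pair `s`. -/
def tabulated (V : Profile) (w : ProfileWord → List Γ')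
    (s : Fin V.numCandidates × Fin V.numCandidates) :
    Set (Fin V.numCandidates × Fin V.numCandidates) :=
  {q | (w .table)[s.1 * V.encode.length ^ 3 + (s.2 * V.encode.length ^ 2 +
    (q.1 * V.encode.length + q.2))]? = some (.bit true)}

variable {p q s : Fin V.numCandidates × Fin V.numCandidates}

theorem holds_stepBy {S : ProfileVar → ProfileFormula} {A : Set (Fin V.numCandidates)}
    (hS : ∀ u (a : Fin V.numCandidates), x u = a → ((S u).Holds w x ↔ a ∈ A))
    (hp₁ : x middle₁ = p.1) (hp₂ : x middle₂ = p.2) (hq₁ : x target₁ = q.1)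
    (hq₂ : x target₂ = q.2) :
    (stepBy S).Holds w x ↔ ∃ a ∈ A, ∃ b ∈ A, ∃ c ∉ A,
      (p = (a, c) ∧ q = (b, c)) ∨ (p = (c, a) ∧ q = (c, b)) := by
  simp only [stepBy, holds_or, holds_and, holds_not, holds_eq_var hp₁ hq₁, holds_eq_var hp₂ hq₂,
    hS _ _ hp₁, hS _ _ hp₂, hS _ _ hq₁, hS _ _ hq₂, Prod.ext_iff]
  constructor
  · rintro (⟨⟨hp, hq⟩, hn, e⟩ | ⟨⟨hp, hq⟩, hn, e⟩)
    · exact ⟨_, hp, _, hq, _, hn, .inl ⟨⟨rfl, rfl⟩, rfl, e.symm⟩⟩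
    · exact ⟨_, hp, _, hq, _, hn, .inr ⟨⟨rfl, rfl⟩, e.symm, rfl⟩⟩
  · rintro ⟨a, ha, b, hb, c, hc, ⟨⟨rfl, rfl⟩, rfl, e⟩ | ⟨⟨rfl, rfl⟩, e, rfl⟩⟩
    · exact .inl ⟨⟨ha, hb⟩, hc, e.symm⟩
    · exact .inr ⟨⟨ha, hb⟩, hc, e.symm⟩

theorem holds_step (h : Reads V w x) (hp₁ : x middle₁ = p.1) (hp₂ : x middle₂ = p.2)
    (hq₁ : x target₁ = q.1) (hq₂ : x target₂ = q.2) :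
    step.Holds w x ↔ ForcingStep V.intervals p q := by
  rw [step, holds_exVote h, ForcingStep, V.exists_mem_intervals_iff]
  refine exists_congr fun t => exists_congr fun v => and_congr_right fun hv => ?_
  have h := h.update (u := vote) (by decide) t
  rw [holds_exCandidate h (by decide)]
  refine exists_congr fun d => ?_
  have h := h.update (u := cut) (by decide) d
  set y := Function.update (Function.update x vote t) cut d
  have hv : V.votes[y vote]? = some v := hv
  have hd : y cut = d := rfl
  rw [holds_or, holds_and, holds_exCandidate h (by decide)]
  refine or_congr ?_ (and_congr (exists_congr fun e => ?_) ?_)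
  · exact holds_stepBy (fun u a ha => holds_rel h hv ha hd) hp₁ hp₂ hq₁ hq₂
  · exact holds_prefers (h.update (by decide) e) hv hd rfl
  · refine holds_stepBy (fun u a ha => ?_) hp₁ hp₂ hq₁ hq₂
    rw [holds_or, holds_prefers h hv ha hd, holds_eq_var ha hd, Set.mem_ofPred_eq]

theorem holds_haveTop (h : Reads V w x) :
    haveTop.Holds w x ↔ ∀ v ∈ V.votes, ∃ p, v.IsTop p := by
  simp only [haveTop, holds_not, holds_exVote h, not_exists, not_and, not_not,
    List.mem_iff_getElem?, forall_exists_index]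
  rw [forall_comm]
  refine forall_congr' fun v => forall_congr' fun t => forall_congr' fun hv => ?_
  have h := h.update (u := vote) (by decide) t
  rw [holds_exCandidate h (by decide)]
  refine exists_congr fun p => ?_
  have h := h.update (u := cut) (by decide) p
  rw [holds_allCandidates h (by decide)]
  refine forall_congr' fun c => ?_
  have h := h.update (u := worse) (by decide) c
  set y := Function.update (Function.update (Function.update x vote t) cut p) worse c
  have hv : V.votes[y vote]? = some v := hv
  have hp : y cut = p := rfl
  have hc : y worse = c := rfl
  rw [holds_or, holds_eq_var hc hp, holds_prefers h hv hp hc, or_iff_not_imp_left]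

theorem holds_linked {u₁ u₂ v₁ v₂ : ProfileVar} (h : Reads V w x) (hs₁ : x u₁ = s.1)
    (hs₂ : x u₂ = s.2) (hq₁ : x v₁ = q.1) (hq₂ : x v₂ = q.2) :
    (linked u₁ u₂ v₁ v₂).Holds w x ↔ q ∈ tabulated V w s := by
  simp only [linked, entry, holds_symbol, pow_succ, pow_zero, one_mul, value_add, value_mul,
    value_var, value_length, h.input_eq, hs₁, hs₂, hq₁, hq₂, tabulated, Set.mem_ofPred_eq]

theorem holds_linkedNext (hw : w .input = V.encode) (hs₁ : x source₁ = s.1)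
    (hs₂ : x source₂ = s.2) (hq₁ : x target₁ = q.1) (hq₂ : x target₂ = q.2) :
    linkedNext.Holds w x ↔ s = q ∨ ∃ p ∈ tabulated V w s, ForcingStep V.intervals p q := by
  rw [linkedNext, holds_withSize hw]
  have h := reads_update_size (x := x) hw
  set y := Function.update x size V.numCandidates
  have hs₁ : y source₁ = s.1 := hs₁
  have hs₂ : y source₂ = s.2 := hs₂
  have hq₁ : y target₁ = q.1 := hq₁
  have hq₂ : y target₂ = q.2 := hq₂
  rw [holds_or, holds_and, holds_eq_var hs₁ hq₁, holds_eq_var hs₂ hq₂, Prod.ext_iff,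
    holds_exCandidate h (by decide), Prod.exists]
  refine or_congr_right (exists_congr fun p₁ => ?_)
  have h := h.update (u := middle₁) (by decide) p₁
  rw [holds_exCandidate h (by decide)]
  refine exists_congr fun p₂ => ?_
  have h := h.update (u := middle₂) (by decide) p₂
  exact and_congr (holds_linked (q := (p₁, p₂)) h hs₁ hs₂ rfl rfl)
    (holds_step (p := (p₁, p₂)) h rfl rfl hq₁ hq₂)

theorem holds_noneLinkedToSwap (h : Reads V w x) :
    noneLinkedToSwap.Holds w x ↔
      ∀ q : Fin V.numCandidates × Fin V.numCandidates, q.1 ≠ q.2 → q.swap ∉ tabulated V w q := by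
  rw [noneLinkedToSwap, holds_allCandidates h (by decide), Prod.forall]
  refine forall_congr' fun a => ?_
  have h := h.update (u := source₁) (by decide) a
  rw [holds_allCandidates h (by decide)]
  refine forall_congr' fun b => ?_
  have h := h.update (u := source₂) (by decide) b
  set y := Function.update (Function.update x source₁ a) source₂ b
  have ha : y source₁ = a := rfl
  have hb : y source₂ = b := rfl
  rw [holds_or, holds_not, holds_eq_var ha hb,
    holds_linked (s := (a, b)) (q := (b, a)) h ha hb hb ha, or_iff_not_imp_left]
  rfl

theorem tabulated_searchRound (hw : w .input = V.encode) :
    tabulated V (searchRound w) s =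
      {q | s = q ∨ ∃ p ∈ tabulated V w s, ForcingStep V.intervals p q} := by
  classical
  have hlt (a : Fin V.numCandidates) : (a : ℕ) < (w .input).length :=
    hw ▸ a.2.trans V.numCandidates_lt_length_encode
  have index_lt_pow {n a k b : ℕ} (ha : a < n) (hb : b < n ^ k) : a * n ^ k + b < n ^ (k + 1) :=
    (index_lt ha hb).trans_eq (pow_succ' n k).symm
  ext q
  set x : ProfileVar → ℕ := Function.update (Function.update (Function.update
    (Function.update 0 source₁ s.1) source₂ s.2) target₁ q.1) target₂ q.2
  have lt₁ := index_lt_pow (k := 0) (hlt q.2) Nat.zero_lt_one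
  have lt₂ := index_lt_pow (hlt q.1) lt₁
  have lt₃ := index_lt_pow (hlt s.2) lt₂
  have lookup : (table .input linkedNext w [source₁, source₂, target₁, target₂] 0)[
      s.1 * (w .input).length ^ 3 + (s.2 * (w .input).length ^ 2 +
        (q.1 * (w .input).length + q.2))]? = some (.bit (decide (linkedNext.Holds w x))) := by
    simpa only [List.length_cons, List.length_nil, Nat.reduceAdd, zero_add, pow_zero, pow_one,
      mul_one, add_zero, table, List.getElem?_cons_zero] using
      (getElem?_table_cons (vs := [source₂, target₁, target₂]) (hlt s.1) lt₃).trans <|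
        (getElem?_table_cons (hlt s.2) lt₂).trans <|
        (getElem?_table_cons (hlt q.1) lt₁).trans (getElem?_table_cons (hlt q.2) Nat.zero_lt_one)
  rw [Set.mem_ofPred_eq, ← holds_linkedNext (x := x) (s := s) (q := q) hw rfl rfl rfl rfl,
    tabulated, searchRound, refill, Set.mem_ofPred_eq, Function.update_self, ← hw, lookup]
  simp only [Option.some_inj, Γ'.bit.injEq, decide_eq_true_eq]

theorem iterate_searchRound_input (i : ℕ) : searchRound^[i] w .input = w .input :=
  iterate_refill_of_ne (by decide) _ _ _ _ _

theorem tabulated_iterate_searchRound (hw : w .input = V.encode) (hw' : w .table = []) :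
    tabulated V (searchRound^[V.encode.length ^ 2] w) s = {q | Linked V.intervals s q} := by
  refine stages_eq_reflTransGen (S := fun i => tabulated V (searchRound^[i] w) s)
    ?_ (fun i => ?_) ?_
  · simp [tabulated, hw']
  · simp only [Function.iterate_succ_apply']
    exact tabulated_searchRound ((iterate_searchRound_input i).trans hw)
  · simpa [sq] using Nat.mul_self_le_mul_self V.numCandidates_lt_length_encode.le

theorem holds_existsAxis (hw : w .input = V.encode) (hw' : w .table = []) :
    existsAxis.Holds (searchRound^[V.encode.length ^ 2] w) 0 ↔
      ∃ L, V.IsSinglePeakedWithOutsideOptions L := by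
  have input_eq := (iterate_searchRound_input (V.encode.length ^ 2)).trans hw
  have reads := reads_update_size (x := 0) input_eq
  rw [V.exists_axis_iff, existsAxis, holds_withSize input_eq, holds_and, holds_haveTop reads,
    holds_noneLinkedToSwap reads]
  simp only [tabulated_iterate_searchRound hw hw', Set.mem_ofPred_eq]

end Semantics

end ProfileFormula

theorem mainTheorem5 :
    DecidableInPolyTime Profile.encode
      (fun V => ∃ L : Axis (Fin V.numCandidates), V.IsSinglePeakedWithOutsideOptions L) := by
  refine WordFormula.decidableInPolyTime _ _ (k := ProfileWord.input) (r := .table) (by decide)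
    ProfileFormula.linkedNext [.source₁, .source₂, .target₁, .target₂]
    (WordFormula.length .input ^ 2) ProfileFormula.existsAxis fun V w input_eq words_nil => ?_
  rw [WordFormula.value_pow, WordFormula.value_length, input_eq]
  exact (ProfileFormula.holds_existsAxis input_eq (words_nil _ (by decide))).symm
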